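/- Let $n\ge 3$ and let $\Omega\subset\mathbb{R}^n$ be a nonempty bounded open convex set with $C^{1,1}$ boundary; put $\Omega^{\mathrm{ext}}=\mathbb{R}^n\setminus\overline{\Omega}$. Let $\sigma_1(\Omega^{\mathrm{ext}})$ be the first eigenvalue of the exterior Steklov problem, i.e. the smallest $\sigma\in\mathbb{R}$ for which there is a nonzero $u:\Omega^{\mathrm{ext}}\to\mathbb{R}$ with $u\in H^1(\Omega^{\mathrm{ext}}\cap B_R)$ for all large $R$, where $B_R=\{|x|<R\}$, such that $$\Delta u=0 \text{ in } \Omega^{\mathrm{ext}},\qquad \partial_\nu u=\sigma u \text{ on } \partial\Omega,\qquad u(x)=O(|x|^{2-n}) \text{ as } |x|\to\infty,$$ where $\nu$ is the unit normal to $\partial\Omega$ pointing into $\Omega$, the trace of $u$ on $\partial\Omega$ is taken in the Sobolev sense, and the equation and the boundary condition are understood in the weak sense (Green's formula). For distinct positive numbers $\alpha_1,\dots,\alpha_k$, $k\ge 2$, define the logarithmic mean $$L(\alpha_1,\dots,\alpha_k)=\Bigg((k-1)\sum_{j=1}^{k}\frac{\alpha_j^{k-2}}{\prod_{i\ne j}(\alpha_j-\alpha_i)}\log\alpha_j\Bigg)^{-1},$$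 and extend $L$ to arbitrary nonnegative $\alpha_1,\dots,\alpha_k$ as the limit of this expression from tuples of distinct positive numbers. Let $\kappa_1(s),\dots,\kappa_{n-1}(s)\ge 0$ be the principal curvatures of $\partial\Omega$ at $s$, i.e. the eigenvalues of the derivative along $\partial\Omega$ of the unit normal pointing out of $\Omega$; they are defined at almost every $s\in\partial\Omega$. Then $$\sigma_1(\Omega^{\mathrm{ext}})\ \ge\ (n-2)\,\inf_{s}\,L\big(\kappa_1(s),\dots,\kappa_{n-1}(s)\big),$$ where the infimum is taken over those $s\in\partial\Omega$ at which the principal curvatures are defined. -/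

import Mathlib

open Set Filter Topology MeasureTheory
open scoped NNReal ENNReal ContDiff RealInnerProductSpace

namespace ExteriorSteklov

/-- Euclidean space `ℝⁿ`. -/
abbrev Euc (n : ℕ) : Type := EuclideanSpace ℝ (Fin n)

/-! ### Geometry of the boundary -/

/-- `∂Ω ∈ C^{1,1}`: near each of its boundary points, `Ω` is, with respect to some direction `e`,
the region strictly below the graph of a `C^{1,1}` function `g` of the coordinates orthogonal
to `e`. -/
def HasC11Boundary {n : ℕ} (Ω : Set (Euc n)) : Prop :=
  ∀ s ∈ frontier Ω, ∃ (e : Euc n) (g : (Submodule.span ℝ {e})ᗮ → ℝ) (C : ℝ≥0) (r : ℝ),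
    ‖e‖ = 1 ∧ ContDiff ℝ 1 g ∧ LipschitzWith C (fderiv ℝ g) ∧ 0 < r ∧
    ∀ x ∈ Metric.ball s r,
      (x ∈ Ω ↔ ⟪x, e⟫ < g ((Submodule.span ℝ {e})ᗮ.orthogonalProjectionOnto x))

/-- `v` is the unit normal to `∂Ω` at `s` that points out of `Ω`: short segments issuing from `s`
lie in `Ω` if their direction has negative scalar product with `v`, and lie outside the closure
of `Ω` if it is positive. -/
def IsOuterUnitNormal {n : ℕ} (Ω : Set (Euc n)) (s v : Euc n) : Prop :=
  ‖v‖ = 1 ∧ ∀ w : Euc n,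
    (⟪v, w⟫ < 0 → ∀ᶠ t : ℝ in 𝓝[>] 0, s + t • w ∈ Ω) ∧
    (0 < ⟪v, w⟫ → ∀ᶠ t : ℝ in 𝓝[>] 0, s + t • w ∉ closure Ω)

/-- The Gauss map of `∂Ω`, pointing out of `Ω` (its values off `∂Ω` are irrelevant). -/
noncomputable def outerNormal {n : ℕ} (Ω : Set (Euc n)) (s : Euc n) : Euc n :=
  Classical.epsilon (IsOuterUnitNormal Ω s)

/-- The principal curvatures of `∂Ω` at `s` are defined, and are `κ₁, …, κ_{n-1}` (with
multiplicity, in some order): the Gauss map is differentiable along `∂Ω` at `s`, and its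
derivative, the shape operator, is diagonal with entries `κ_j` in an orthonormal basis `e` of the
tangent space. They are nonnegative for convex `Ω`, and equal `1 / r` for a ball of radius `r`. -/
def HasPrincipalCurvatures {n : ℕ} (Ω : Set (Euc n)) (s : Euc n) (κ : Fin (n - 1) → ℝ) : Prop :=
  s ∈ frontier Ω ∧ ∃ (A : Euc n →L[ℝ] Euc n) (e : Fin (n - 1) → Euc n),
    HasFDerivWithinAt (outerNormal Ω) A (frontier Ω) s ∧
    Orthonormal ℝ e ∧ (∀ j, ⟪outerNormal Ω s, e j⟫ = 0) ∧
    ∀ j, A (e j) = κ j • e j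

/-- The surface measure `dS` on `∂Ω`: the `(n-1)`-dimensional Hausdorff measure, normalised so as
to agree with Lebesgue measure on hyperplanes. -/
noncomputable def surfaceMeasure {n : ℕ} (Ω : Set (Euc n)) : Measure (Euc n) :=
  (Measure.euclideanHausdorffMeasure (n - 1)).restrict (frontier Ω)

/-! ### The logarithmic mean -/

/-- The explicit expression for the logarithmic mean of distinct positive numbers. -/
noncomputable def logMeanFormula {k : ℕ} (α : Fin k → ℝ) : ℝ :=
  1 / (((k : ℝ) - 1) *
    ∑ j, α j ^ (k - 2) / (∏ i ∈ Finset.univ.erase j, (α j - α i)) * Real.log (α j))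

/-- Tuples of distinct positive numbers. -/
def distinctPos (k : ℕ) : Set (Fin k → ℝ) := {α | Function.Injective α ∧ ∀ i, 0 < α i}

open Classical in
/-- The logarithmic mean of `k ≥ 2` nonnegative numbers: the explicit expression if they are
distinct and positive, and otherwise its limit from tuples of distinct positive numbers. -/
noncomputable def logMean {k : ℕ} (α : Fin k → ℝ) : ℝ :=
  if α ∈ distinctPos k then logMeanFormula α
  else limUnder (𝓝[distinctPos k] α) logMeanFormula

/-! ### The exterior Steklov problem -/

/-- The exterior domain. -/
def ext {n : ℕ} (Ω : Set (Euc n)) : Set (Euc n) := (closure Ω)ᶜ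

/-- `φ ∈ C_c^∞(U)`. -/
def IsTest {n : ℕ} (U : Set (Euc n)) (φ : Euc n → ℝ) : Prop :=
  ContDiff ℝ ∞ φ ∧ HasCompactSupport φ ∧ tsupport φ ⊆ U

/-- Lebesgue measure on the truncated exterior domain `Ω^ext ∩ B_R`. -/
noncomputable def truncVolume {n : ℕ} (Ω : Set (Euc n)) (R : ℝ) : Measure (Euc n) :=
  volume.restrict (ext Ω ∩ Metric.ball 0 R)

/-- `u ∈ H¹_loc(Ω^ext)` with weak gradient `G`: both are square integrable on `Ω^ext ∩ B_R` for
every `R` (thus up to `∂Ω`). -/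
def IsH1Loc {n : ℕ} (Ω : Set (Euc n)) (u : Euc n → ℝ) (G : Euc n → Euc n) : Prop :=
  (∀ R : ℝ, MemLp u 2 (truncVolume Ω R) ∧ MemLp G 2 (truncVolume Ω R)) ∧
  ∀ φ : Euc n → ℝ, IsTest (ext Ω) φ → ∀ v : Euc n,
    ∫ x in ext Ω, u x * ⟪gradient φ x, v⟫ = - ∫ x in ext Ω, ⟪G x, v⟫ * φ x

/-- `f ∈ L²(∂Ω)` is the trace on `∂Ω` of `u ∈ H¹_loc(Ω^ext)` with weak gradient `G`: it is the
limit in `L²(∂Ω)` of the restrictions of functions `φ k ∈ C_c^∞(ℝⁿ)` that converge to `u` in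
`H¹(Ω^ext ∩ B_R)` for every `R`. -/
def HasTrace {n : ℕ} (Ω : Set (Euc n)) (u : Euc n → ℝ) (G : Euc n → Euc n) (f : Euc n → ℝ) :
    Prop :=
  MemLp f 2 (surfaceMeasure Ω) ∧
  ∃ φ : ℕ → Euc n → ℝ, (∀ k, IsTest univ (φ k)) ∧
    (∀ R : ℝ, Tendsto (fun k => eLpNorm (fun x => φ k x - u x) 2 (truncVolume Ω R)) atTop (𝓝 0)) ∧
    (∀ R : ℝ, Tendsto (fun k => eLpNorm (fun x => gradient (φ k) x - G x) 2 (truncVolume Ω R))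
      atTop (𝓝 0)) ∧
    Tendsto (fun k => eLpNorm (fun x => φ k x - f x) 2 (surfaceMeasure Ω)) atTop (𝓝 0)

/-- `u` is harmonic in `Ω^ext` in the weak sense (`G` is its weak gradient). -/
def IsWeaklyHarmonic {n : ℕ} (Ω : Set (Euc n)) (G : Euc n → Euc n) : Prop :=
  ∀ φ : Euc n → ℝ, IsTest (ext Ω) φ → ∫ x in ext Ω, ⟪G x, gradient φ x⟫ = 0

/-- The normal derivative on `∂Ω`, in the direction of the unit normal pointing out of `Ω^ext`
(into `Ω`), of a weakly harmonic function on `Ω^ext` with weak gradient `G`, equals `h` in the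
weak sense, that is, in the sense of Green's formula. -/
def HasNormalDerivative {n : ℕ} (Ω : Set (Euc n)) (G : Euc n → Euc n) (h : Euc n → ℝ) : Prop :=
  ∀ φ : Euc n → ℝ, IsTest univ φ →
    ∫ x in ext Ω, ⟪G x, gradient φ x⟫ = ∫ x, h x * φ x ∂(surfaceMeasure Ω)

/-- `u = O(|x|^{2-n})` as `|x| → ∞` in `Ω^ext`. -/
def DecaysAtInfinity {n : ℕ} (Ω : Set (Euc n)) (u : Euc n → ℝ) : Prop :=
  ∃ C R : ℝ, ∀ᵐ x ∂(volume.restrict (ext Ω)), R ≤ ‖x‖ → |u x| ≤ C * ‖x‖ ^ (2 - (n : ℝ))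

/-- `σ` is an eigenvalue of the exterior Steklov problem: there is a nonzero
`u ∈ H¹_loc(Ω^ext)` with `Δu = 0` in `Ω^ext`, `∂_ν u = σ u` on `∂Ω`, and
`u = O(|x|^{2-n})` at infinity. -/
def IsEigenvalue {n : ℕ} (Ω : Set (Euc n)) (σ : ℝ) : Prop :=
  ∃ (u : Euc n → ℝ) (G : Euc n → Euc n) (f : Euc n → ℝ),
    ¬ (u =ᵐ[volume.restrict (ext Ω)] 0) ∧
    IsH1Loc Ω u G ∧ HasTrace Ω u G f ∧
    IsWeaklyHarmonic Ω G ∧ HasNormalDerivative Ω G (fun x => σ * f x) ∧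
    DecaysAtInfinity Ω u

/-- The first exterior Steklov eigenvalue `σ₁(Ω^ext)`, the infimum of all eigenvalues, taken in
the extended reals so that no junk value can arise. -/
noncomputable def firstEigenvalue {n : ℕ} (Ω : Set (Euc n)) : EReal :=
  ⨅ σ ∈ {σ : ℝ | IsEigenvalue Ω σ}, (σ : EReal)

end ExteriorSteklov

namespace ExteriorSteklov

/-! ### The logarithmic mean as an integral -/

/-! The logarithmic mean is an integral in disguise: by partial fractions `(k - 1) L(κ) = 1 / I(κ)`
with `I(κ) = ∫₀^∞ dt / ∏ᵢ (1 + t κᵢ)` (`mul_logMean`). For `k = n - 1` the product is the Jacobian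
of the normal coordinates `(s, t) ↦ s + t ν(s)`, so the claim compares boundary mass with Dirichlet
energy along exterior normal rays.

On one ray, `φ(s)² ≤ (∫ |∂ₜφ|)²`, and Cauchy–Schwarz with weight `J = ∏ᵢ (1 + t κᵢ)` gives `φ(s)² /
I(κ) ≤ ∫ J |∂ₜφ|² dt` (`sq_mul_inv_tubeIntegral_le`). Convexity makes the rays disjoint and the
curvatures nonnegative; the `C^{1,1}` regularity gives curvatures almost everywhere by Rademacher's
theorem. Integrating over `∂Ω` yields `Λ ∫_∂Ω φ² ≤ ∫_ext |∇φ|²` for every `Λ ≤ inf 1 / I(κ)`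
(`mul_lintegral_sq_le_energy`). The rays need not be shown to cover the exterior, and no area
formula for surface measure is needed: on small patches the parametrization is almost isometric, and
the loss tends to zero.

For an eigenfunction `u` with trace `f` and a cutoff `χ` at scale `R`, Green's formula gives `∫
|∇(χu)|² = σ ∫ f² + ∫ u² |∇χ|²`, and the decay of `u` makes the last term `O(1/R)`. Hence `Λ ∫ f² ≤
σ ∫ f²`. If `f = 0`, the energy vanishes, and a Hardy-type inequality
(`exists_lintegral_sq_le_energy`) forces `u = 0`. -/

/-- The integral `∫₀^∞ dt / ∏ᵢ (1 + t κᵢ)`, which may be infinite. -/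
noncomputable def tubeIntegral {k : ℕ} (κ : Fin k → ℝ) : ℝ≥0∞ :=
  ∫⁻ t in Ioi (0 : ℝ), ENNReal.ofReal (∏ i, (1 + t * κ i))⁻¹

theorem one_le_one_add_mul {t a : ℝ} (ht : 0 < t) (ha : 0 ≤ a) : 1 ≤ 1 + t * a := by
  have := mul_nonneg ht.le ha
  linarith

theorem prod_one_add_mul_pos {k : ℕ} {κ : Fin k → ℝ} (hκ : ∀ i, 0 ≤ κ i) {t : ℝ} (ht : 0 < t) :
    0 < ∏ i, (1 + t * κ i) :=
  Finset.prod_pos fun i _ => zero_lt_one.trans_le (one_le_one_add_mul ht (hκ i))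

open Polynomial in
/-- Partial fraction decomposition of `1 / ∏ᵢ (1 + t αᵢ)`. -/
theorem inv_prod_one_add_mul {k : ℕ} (hk : 1 ≤ k) {α : Fin k → ℝ} (hα : Function.Injective α)
    {t : ℝ} (ht : t ≠ 0) (h : ∀ i, 1 + t * α i ≠ 0) :
    (∏ i, (1 + t * α i))⁻¹ =
      ∑ j, α j ^ (k - 1) / (∏ i ∈ Finset.univ.erase j, (α j - α i)) * (1 + t * α j)⁻¹ := by
  -- The decomposition is Lagrange interpolation of `x^(k-1)` at the nodes `αᵢ`, evaluated at `x =
  -- -1/t`, where `x - αᵢ` is `1 + t αᵢ` up to the factor `-1/t`.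
  have hx : ∀ i, -t⁻¹ - α i = -(t⁻¹ * (1 + t * α i)) := fun i => by
    field_simp
    ring
  have hne : ∀ i ∈ (Finset.univ : Finset (Fin k)), -t⁻¹ ≠ α i := fun i _ h0 => by
    have := hx i
    rw [h0, sub_self, eq_comm, neg_eq_zero, mul_eq_zero] at this
    exact this.elim (inv_ne_zero ht) (h i)
  have hdeg : (X ^ (k - 1) : ℝ[X]).degree < (Finset.univ : Finset (Fin k)).card := by
    rw [degree_X_pow, Finset.card_univ, Fintype.card_fin]
    exact_mod_cast Nat.sub_lt hk one_pos
  have h1 := congrArg (eval (-t⁻¹))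
    (Lagrange.eq_interpolate (s := Finset.univ) (v := α) hα.injOn hdeg)
  rw [Lagrange.eval_interpolate_not_at_node _ hne, Lagrange.eval_nodal] at h1
  simp only [eval_pow, eval_X, hx, Finset.prod_neg, Finset.prod_mul_distrib, Finset.prod_const,
    Finset.card_univ, Fintype.card_fin, Lagrange.nodalWeight, Finset.prod_inv_distrib] at h1
  have hP : ∏ i, (1 + t * α i) ≠ 0 := Finset.prod_ne_zero_iff.2 fun i _ => h i
  obtain ⟨m, rfl⟩ : ∃ m, k = m + 1 := ⟨k - 1, by omega⟩
  have h2 : ∀ j, (∏ i ∈ Finset.univ.erase j, (α j - α i))⁻¹ * (-(t⁻¹ * (1 + t * α j)))⁻¹ *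
      α j ^ (m + 1 - 1) =
      -t * (α j ^ (m + 1 - 1) / (∏ i ∈ Finset.univ.erase j, (α j - α i)) * (1 + t * α j)⁻¹) :=
    fun j => by
      rw [inv_neg, mul_inv, inv_inv, div_eq_mul_inv]
      ring
  simp only [h2, ← Finset.mul_sum] at h1
  set S := ∑ j, α j ^ (m + 1 - 1) / (∏ i ∈ Finset.univ.erase j, (α j - α i)) * (1 + t * α j)⁻¹
  have h3 : (-t⁻¹) ^ m * ((∏ i, (1 + t * α i)) * S) = (-t⁻¹) ^ m * 1 := by
    rw [mul_one]
    rw [Nat.add_sub_cancel] at h1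
    refine Eq.trans ?_ h1.symm
    rw [neg_pow t⁻¹, pow_succ, pow_succ]
    field_simp
  exact inv_eq_of_mul_eq_one_right (mul_left_cancel₀
    (pow_ne_zero _ (neg_ne_zero.2 (inv_ne_zero ht))) h3)

open Polynomial in
-- The sum is the `x^(k-1)` coefficient of the interpolant of `x^(k-2)`, which is `x^(k-2)` itself.
-- Its vanishing cancels the logarithmic divergence of the primitive of `1 / ∏ᵢ (1 + t αᵢ)` at
-- infinity.
theorem sum_pow_div_prod_eq_zero {k : ℕ} (hk : 2 ≤ k) {α : Fin k → ℝ}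
    (hα : Function.Injective α) :
    ∑ j, α j ^ (k - 2) / (∏ i ∈ Finset.univ.erase j, (α j - α i)) = 0 := by
  have hdeg : (X ^ (k - 2) : ℝ[X]).degree < (Finset.univ : Finset (Fin k)).card := by
    rw [degree_X_pow, Finset.card_univ, Fintype.card_fin]
    exact_mod_cast Nat.sub_lt (by omega) two_pos
  have h1 := Lagrange.coeff_eq_sum (s := Finset.univ) (v := α) hα.injOn hdeg
  rw [Finset.card_univ, Fintype.card_fin, coeff_X_pow, if_neg (by omega)] at h1
  simpa using h1.symm

theorem tubeIntegral_of_distinctPos {k : ℕ} (hk : 2 ≤ k) {α : Fin k → ℝ}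
    (hα : α ∈ distinctPos k) :
    tubeIntegral α = ENNReal.ofReal
      (∑ j, α j ^ (k - 2) / (∏ i ∈ Finset.univ.erase j, (α j - α i)) * Real.log (α j)) := by
  set d : Fin k → ℝ := fun j => α j ^ (k - 2) / (∏ i ∈ Finset.univ.erase j, (α j - α i)) with hd
  have hpos : ∀ t, 0 ≤ t → ∀ j, 0 < 1 + t * α j := fun t ht j => by
    have := mul_nonneg ht (hα.2 j).le
    linarith
  set g : ℝ → ℝ := fun t => ∑ j, d j * Real.log (1 + t * α j) with hg
  have hderiv' : ∀ t, 0 ≤ t → HasDerivAt g (∑ j, d j * ((1 + t * α j)⁻¹ * α j)) t := fun t ht => by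
    refine HasDerivAt.fun_sum fun j _ => HasDerivAt.const_mul _ ?_
    have h1 : HasDerivAt (fun t : ℝ => 1 + t * α j) (α j) t := by
      simpa using ((hasDerivAt_id t).mul_const (α j)).const_add 1
    simpa [div_eq_inv_mul] using h1.log (hpos t ht j).ne'
  have hderiv : ∀ t ∈ Ioi (0 : ℝ), HasDerivAt g (∏ i, (1 + t * α i))⁻¹ t := fun t ht => by
    rw [inv_prod_one_add_mul (by omega) hα.1 (ne_of_gt ht) fun i => (hpos t (le_of_lt ht) i).ne']
    convert hderiv' t (le_of_lt ht) using 2 with j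
    obtain ⟨m, rfl⟩ : ∃ m, k = m + 2 := ⟨k - 2, by omega⟩
    simp only [hd, Nat.add_sub_cancel, show m + 2 - 1 = m + 1 by omega, pow_succ]
    ring
  have hnonneg : ∀ t ∈ Ioi (0 : ℝ), 0 ≤ (∏ i, (1 + t * α i))⁻¹ := fun t ht =>
    (inv_pos.2 (prod_one_add_mul_pos (fun i => (hα.2 i).le) ht)).le
  have hlim : Tendsto g atTop (𝓝 (∑ j, d j * Real.log (α j))) := by
    have h1 : Tendsto (fun t : ℝ => ∑ j, d j * Real.log (t⁻¹ + α j)) atTop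
        (𝓝 (∑ j, d j * Real.log (α j))) := by
      refine tendsto_finsetSum _ fun j _ => Tendsto.const_mul _ ?_
      refine Tendsto.log ?_ (hα.2 j).ne'
      simpa using tendsto_inv_atTop_zero.add_const (α j)
    refine h1.congr' ?_
    filter_upwards [eventually_gt_atTop 0] with t ht
    -- The divergent part `log t` does not depend on `j`, so it enters with total coefficient `∑ dⱼ
    -- = 0`.
    have h2 : ∀ j, Real.log (1 + t * α j) = Real.log t + Real.log (t⁻¹ + α j) := fun j => by
      have := inv_pos.2 ht
      rw [← Real.log_mul ht.ne' (by linarith [hα.2 j])]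
      congr 1
      field_simp
    simp only [hg, h2, mul_add, Finset.sum_add_distrib, ← Finset.sum_mul]
    rw [show ∑ j, d j = 0 from sum_pow_div_prod_eq_zero hk hα.1]
    ring
  have hcont : ContinuousWithinAt g (Ici 0) 0 := (hderiv' 0 le_rfl).continuousAt.continuousWithinAt
  have h3 := integral_Ioi_of_hasDerivAt_of_nonneg hcont hderiv hnonneg hlim
  have h4 := integrableOn_Ioi_deriv_of_nonneg hcont hderiv hnonneg hlim
  rw [tubeIntegral, ← ofReal_integral_eq_lintegral_ofReal h4
    ((ae_restrict_iff' measurableSet_Ioi).2 (ae_of_all _ hnonneg)), h3]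
  simp [hg, hd]

theorem measurable_inv_prod {k : ℕ} (κ : Fin k → ℝ) :
    Measurable fun t : ℝ => ENNReal.ofReal (∏ i, (1 + t * κ i))⁻¹ := by
  fun_prop

/-- Makes `(tubeIntegral κ)⁻¹` finite, so it can be read as a real number. It is `0` when the
integral diverges, for instance when all `κᵢ` vanish. -/
theorem tubeIntegral_ne_zero {k : ℕ} {κ : Fin k → ℝ} (hκ : ∀ i, 0 ≤ κ i) :
    tubeIntegral κ ≠ 0 := by
  rw [tubeIntegral, Ne, lintegral_eq_zero_iff (measurable_inv_prod κ)]
  intro h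
  have h1 : ∀ᵐ t ∂(volume.restrict (Ioi (0 : ℝ))), False := by
    filter_upwards [h, ae_restrict_mem measurableSet_Ioi] with t ht h0
    have := inv_pos.2 (prod_one_add_mul_pos hκ h0)
    simp only [Pi.zero_apply, ENNReal.ofReal_eq_zero] at ht
    linarith
  rw [eventually_false_iff_eq_bot, ae_eq_bot, Measure.restrict_eq_zero] at h1
  simp at h1

/-- Fatou's lemma handles an infinite limit, dominated convergence a finite one. -/
theorem tendsto_tubeIntegral {k : ℕ} {κ : Fin k → ℝ} (hκ : ∀ i, 0 ≤ κ i) :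
    Tendsto tubeIntegral (𝓝[distinctPos k] κ) (𝓝 (tubeIntegral κ)) := by
  have hlim : ∀ t ∈ Ioi (0 : ℝ), Tendsto
      (fun α : Fin k → ℝ => ENNReal.ofReal (∏ i, (1 + t * α i))⁻¹) (𝓝[distinctPos k] κ)
      (𝓝 (ENNReal.ofReal (∏ i, (1 + t * κ i))⁻¹)) := fun t ht => by
    refine ENNReal.tendsto_ofReal (Tendsto.inv₀ ?_ (prod_one_add_mul_pos hκ ht).ne')
    refine tendsto_finsetProd _ fun i _ => Tendsto.const_add _ (Tendsto.const_mul _ ?_)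
    exact ((continuous_apply i).tendsto κ).mono_left nhdsWithin_le_nhds
  by_cases hI : tubeIntegral κ = ⊤
  · rcases eq_or_neBot (𝓝[distinctPos k] κ) with hb | hb
    · simp [hb]
    have h1 : tubeIntegral κ ≤ liminf tubeIntegral (𝓝[distinctPos k] κ) := by
      refine le_trans ?_ (lintegral_liminf_le (μ := volume.restrict (Ioi (0 : ℝ)))
        (u := 𝓝[distinctPos k] κ) fun α => measurable_inv_prod α)
      refine lintegral_mono_ae ?_
      filter_upwards [ae_restrict_mem measurableSet_Ioi] with t ht
      exact (hlim t ht).liminf_eq.ge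
    rw [hI, top_le_iff] at h1
    rw [hI]
    exact tendsto_of_le_liminf_of_limsup_le (by rw [h1]) le_top
  -- From `αᵢ ≥ κᵢ / 2` follows `1 + t κᵢ ≤ 2 (1 + t αᵢ)`, so `2^k` times the limit integrand
  -- dominates.
  · have hlow : ∀ᶠ α in 𝓝[distinctPos k] κ, ∀ i, κ i / 2 ≤ α i := by
      rw [eventually_all]
      intro i
      rcases (hκ i).eq_or_lt with h0 | h0
      · filter_upwards [self_mem_nhdsWithin] with α hα
        rw [← h0, zero_div]
        exact (hα.2 i).le
      · have : ∀ᶠ α in 𝓝 κ, κ i / 2 < α i :=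
          (continuous_apply i).tendsto κ |>.eventually (lt_mem_nhds (half_lt_self h0))
        filter_upwards [nhdsWithin_le_nhds this] with α hα using hα.le
    refine tendsto_lintegral_filter_of_dominated_convergence
      (fun t => 2 ^ k * ENNReal.ofReal (∏ i, (1 + t * κ i))⁻¹)
      (Eventually.of_forall fun α => measurable_inv_prod α) ?_ ?_ ?_
    · filter_upwards [hlow] with α hα
      filter_upwards [ae_restrict_mem measurableSet_Ioi] with t ht
      have h2 : ∏ i, (1 + t * κ i) ≤ 2 ^ k * ∏ i, (1 + t * α i) := by
        have : (2 : ℝ) ^ k = ∏ _i : Fin k, (2 : ℝ) := by simp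
        rw [this, ← Finset.prod_mul_distrib]
        refine Finset.prod_le_prod (fun i _ => (zero_le_one.trans
          (one_le_one_add_mul ht (hκ i)))) fun i _ => ?_
        have := mul_le_mul_of_nonneg_left (hα i) (le_of_lt ht)
        linarith
      have h3 := prod_one_add_mul_pos hκ ht
      have h5 : (2 : ℝ≥0∞) ^ k = ENNReal.ofReal (2 ^ k) := by
        rw [ENNReal.ofReal_pow (by norm_num)]; simp
      rw [h5, ← ENNReal.ofReal_mul (by positivity)]
      refine ENNReal.ofReal_le_ofReal ?_
      have h4 : 0 < ∏ i, (1 + t * α i) := by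
        have := h3.trans_le h2
        exact pos_of_mul_pos_right this (by positivity)
      rw [← div_eq_mul_inv, inv_eq_one_div, div_le_div_iff₀ h4 h3]
      linarith
    · rw [lintegral_const_mul _ (measurable_inv_prod κ)]
      exact ENNReal.mul_ne_top (by simp) hI
    · filter_upwards [ae_restrict_mem measurableSet_Ioi] with t ht using hlim t ht

/-- Without this the limit defining `logMean` would not be determined. The tuples `κᵢ + ε (i + 1)`
are positive, and distinct for small `ε > 0`. -/
theorem neBot_nhdsWithin_distinctPos {k : ℕ} {κ : Fin k → ℝ} (hκ : ∀ i, 0 ≤ κ i) :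
    (𝓝[distinctPos k] κ).NeBot := by
  set c : ℝ → Fin k → ℝ := fun ε i => κ i + ε * ((i : ℝ) + 1) with hc
  have h1 : Tendsto c (𝓝[>] 0) (𝓝 κ) := by
    have : Continuous c := by fun_prop
    have h0 : c 0 = κ := by ext i; simp [hc]
    exact h0 ▸ (this.tendsto 0).mono_left nhdsWithin_le_nhds
  have h2 : ∀ᶠ ε in 𝓝[>] (0 : ℝ), c ε ∈ distinctPos k := by
    have h3 : ∀ i j : Fin k, ∀ᶠ ε in 𝓝[>] (0 : ℝ), c ε i = c ε j → i = j := fun i j => by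
      by_cases hij : i = j
      · exact Eventually.of_forall fun _ _ => hij
      have hne : (i : ℝ) - j ≠ 0 := by
        rw [sub_ne_zero]
        exact fun h => hij (Fin.ext (by exact_mod_cast h))
      -- Two given entries coincide for at most one value of `ε`.
      have h4 : ∀ᶠ ε in 𝓝[>] (0 : ℝ), ε ≠ (κ j - κ i) / (i - j) := by
        by_cases h0 : (κ j - κ i) / ((i : ℝ) - j) = 0
        · rw [h0]
          filter_upwards [self_mem_nhdsWithin] with ε hε using ne_of_gt hε
        · exact nhdsWithin_le_nhds (isOpen_ne.mem_nhds (Ne.symm h0))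
      filter_upwards [h4] with ε hε heq
      refine absurd ?_ hε
      rw [eq_div_iff hne]
      simp only [hc] at heq
      linarith
    filter_upwards [eventually_all.2 fun i => eventually_all.2 (h3 i), self_mem_nhdsWithin]
      with ε hε h0
    refine ⟨fun i j h => hε i j h, fun i => ?_⟩
    have : 0 < ε * ((i : ℝ) + 1) := mul_pos h0 (by positivity)
    simp only [hc]
    linarith [hκ i]
  exact (tendsto_nhdsWithin_iff.2 ⟨h1, h2⟩).neBot

theorem mul_logMeanFormula {k : ℕ} (hk : 2 ≤ k) {α : Fin k → ℝ} (hα : α ∈ distinctPos k) :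
    ((k : ℝ) - 1) * logMeanFormula α = ((tubeIntegral α)⁻¹).toReal := by
  have hk' : (k : ℝ) - 1 ≠ 0 := by
    have : (2 : ℝ) ≤ k := by exact_mod_cast hk
    linarith
  have h0 := tubeIntegral_ne_zero fun i => (hα.2 i).le
  rw [tubeIntegral_of_distinctPos hk hα] at h0 ⊢
  rw [Ne, ENNReal.ofReal_eq_zero, not_le] at h0
  rw [ENNReal.toReal_inv, ENNReal.toReal_ofReal h0.le, logMeanFormula]
  field_simp

/-- The logarithmic mean of nonnegative numbers in terms of the integral
`∫₀^∞ dt / ∏ᵢ (1 + t κᵢ)`. -/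
theorem mul_logMean {k : ℕ} (hk : 2 ≤ k) {κ : Fin k → ℝ} (hκ : ∀ i, 0 ≤ κ i) :
    ((k : ℝ) - 1) * logMean κ = ((tubeIntegral κ)⁻¹).toReal := by
  rw [logMean]
  split_ifs with h
  · exact mul_logMeanFormula hk h
  have hk' : (k : ℝ) - 1 ≠ 0 := by
    have : (2 : ℝ) ≤ k := by exact_mod_cast hk
    linarith
  have := neBot_nhdsWithin_distinctPos hκ
  -- Inversion on `[0, ∞]` is continuous also at `∞`, so a divergent integral correctly yields the
  -- mean `0`.
  have h1 : Tendsto (fun α => ((k : ℝ) - 1)⁻¹ * ((tubeIntegral α)⁻¹).toReal)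
      (𝓝[distinctPos k] κ) (𝓝 (((k : ℝ) - 1)⁻¹ * ((tubeIntegral κ)⁻¹).toReal)) := by
    refine Tendsto.const_mul _ ((ENNReal.tendsto_toReal ?_).comp
      ((tendsto_inv_iff (G := ℝ≥0∞)).2 (tendsto_tubeIntegral hκ)))
    simpa using tubeIntegral_ne_zero hκ
  have h2 : Tendsto logMeanFormula (𝓝[distinctPos k] κ)
      (𝓝 (((k : ℝ) - 1)⁻¹ * ((tubeIntegral κ)⁻¹).toReal)) := by
    refine h1.congr' ?_
    filter_upwards [self_mem_nhdsWithin] with α hα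
    rw [← mul_logMeanFormula hk hα, inv_mul_cancel_left₀ hk']
  rw [h2.limUnder_eq, mul_inv_cancel_left₀ hk']

theorem ofReal_mul_logMean {k : ℕ} (hk : 2 ≤ k) {κ : Fin k → ℝ} (hκ : ∀ i, 0 ≤ κ i) :
    ENNReal.ofReal (((k : ℝ) - 1) * logMean κ) = (tubeIntegral κ)⁻¹ := by
  rw [mul_logMean hk hκ, ENNReal.ofReal_toReal]
  simpa using tubeIntegral_ne_zero hκ

theorem logMean_nonneg {k : ℕ} (hk : 2 ≤ k) {κ : Fin k → ℝ} (hκ : ∀ i, 0 ≤ κ i) :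
    0 ≤ logMean κ := by
  have h1 : 0 ≤ ((k : ℝ) - 1) * logMean κ := by
    rw [mul_logMean hk hκ]
    exact ENNReal.toReal_nonneg
  have : (2 : ℝ) ≤ k := by exact_mod_cast hk
  exact nonneg_of_mul_nonneg_right h1 (by linarith)

/-! ### The weighted inequality on a half-line -/

/-- Cauchy–Schwarz for `ℝ≥0∞`-valued functions. -/
theorem sq_lintegral_mul_le {X : Type*} [MeasurableSpace X] (μ : Measure X) {f g : X → ℝ≥0∞}
    (hf : AEMeasurable f μ) (hg : AEMeasurable g μ) :
    (∫⁻ x, f x * g x ∂μ) ^ 2 ≤ (∫⁻ x, f x ^ 2 ∂μ) * ∫⁻ x, g x ^ 2 ∂μ := by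
  have h := ENNReal.lintegral_mul_le_Lp_mul_Lq μ Real.HolderConjugate.two_two hf hg
  simp only [Pi.mul_apply, ENNReal.rpow_two] at h
  calc _ ≤ _ := pow_le_pow_left₀ zero_le h 2
    _ = _ := by
      rw [mul_pow, ← ENNReal.rpow_natCast, ← ENNReal.rpow_natCast, ← ENNReal.rpow_mul,
        ← ENNReal.rpow_mul]
      norm_num

/-- The one-dimensional weighted inequality along normal rays. -/
theorem sq_mul_inv_tubeIntegral_le {k : ℕ} {κ : Fin k → ℝ} (hκ : ∀ i, 0 ≤ κ i) {p : ℝ → ℝ}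
    (hp : ContDiff ℝ 1 p) (hp0 : HasCompactSupport p) :
    ENNReal.ofReal (p 0 ^ 2) * (tubeIntegral κ)⁻¹ ≤
      ∫⁻ t in Ioi (0 : ℝ), ENNReal.ofReal (∏ i, (1 + t * κ i)) * ENNReal.ofReal (deriv p t ^ 2) := by
  have h1 : ENNReal.ofReal |p 0| ≤ ∫⁻ t in Ioi (0 : ℝ), ENNReal.ofReal |deriv p t| := by
    have h2 : ∫ t in Ioi (0 : ℝ), deriv p t = - p 0 := hp0.integral_Ioi_deriv_eq hp 0
    rw [← abs_neg, ← h2, ← Real.norm_eq_abs, ofReal_norm]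
    refine (enorm_integral_le_lintegral_enorm _).trans (le_of_eq ?_)
    simp only [← Real.norm_eq_abs, ofReal_norm]
  set J : ℝ → ℝ := fun t => ∏ i, (1 + t * κ i) with hJ
  have hJm : Measurable J := by fun_prop
  have hdm : Measurable (deriv p) := measurable_deriv p
  -- Splitting `|p'| = (√J |p'|) · J^(-1/2)` prepares Cauchy–Schwarz; the second factor squared
  -- integrates to `tubeIntegral κ`.
  have h3 : ∫⁻ t in Ioi (0 : ℝ), ENNReal.ofReal |deriv p t| =
      ∫⁻ t in Ioi (0 : ℝ), ENNReal.ofReal (√(J t) * |deriv p t|) * ENNReal.ofReal (√(J t))⁻¹ := by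
    refine setLIntegral_congr_fun measurableSet_Ioi fun t ht => ?_
    have : 0 < √(J t) := Real.sqrt_pos.2 (prod_one_add_mul_pos hκ ht)
    rw [← ENNReal.ofReal_mul (by positivity)]
    congr 1
    field_simp
  have h4 : ENNReal.ofReal (p 0 ^ 2) ≤
      (∫⁻ t in Ioi (0 : ℝ), ENNReal.ofReal (J t) * ENNReal.ofReal (deriv p t ^ 2)) *
        tubeIntegral κ := by
    calc ENNReal.ofReal (p 0 ^ 2) = ENNReal.ofReal |p 0| ^ 2 := by
          rw [← ENNReal.ofReal_pow (abs_nonneg _), sq_abs]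
      _ ≤ _ := pow_le_pow_left₀ zero_le (h1.trans_eq h3) 2
      _ ≤ _ := sq_lintegral_mul_le _ (by fun_prop) (by fun_prop)
      _ = _ := by
        congr 1
        · refine setLIntegral_congr_fun measurableSet_Ioi fun t ht => ?_
          have : 0 < J t := prod_one_add_mul_pos hκ ht
          rw [← ENNReal.ofReal_pow (by positivity), mul_pow, Real.sq_sqrt this.le, sq_abs,
            ENNReal.ofReal_mul this.le]
        · refine setLIntegral_congr_fun measurableSet_Ioi fun t ht => ?_
          have : 0 < J t := prod_one_add_mul_pos hκ ht
          rw [← ENNReal.ofReal_pow (by positivity), inv_pow, Real.sq_sqrt this.le]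
  rw [← div_eq_mul_inv]
  exact ENNReal.div_le_of_le_mul h4

end ExteriorSteklov

namespace ExteriorSteklov

/-! ### Outer normals -/

section Normal

variable {n : ℕ} {Ω : Set (Euc n)} {s v : Euc n}

/-- If `v ≠ v'`, the direction `v' - v` points inward with respect to `v` and outward with respect
to `v'`. Uniqueness identifies the value chosen in `outerNormal`. -/
theorem IsOuterUnitNormal.unique {v' : Euc n} (h : IsOuterUnitNormal Ω s v)
    (h' : IsOuterUnitNormal Ω s v') : v = v' := by
  by_contra hne
  have hlt : ⟪v, v'⟫ < 1 := inner_lt_one_iff_real_of_norm_eq_one h.1 h'.1 |>.2 hne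
  have h1 := (h.2 (v' - v)).1 (by
    rw [inner_sub_right, real_inner_self_eq_norm_sq, h.1]; linarith)
  have h2 := (h'.2 (v' - v)).2 (by
    rw [inner_sub_right, real_inner_self_eq_norm_sq, h'.1, real_inner_comm]; linarith)
  obtain ⟨t, ht1, ht2⟩ := (h1.and h2).exists
  exact ht2 (subset_closure ht1)

theorem IsOuterUnitNormal.outerNormal_eq (h : IsOuterUnitNormal Ω s v) : outerNormal Ω s = v :=
  IsOuterUnitNormal.unique (Classical.epsilon_spec ⟨v, h⟩) h

/-- This is the supporting hyperplane: otherwise the segment from `s` to `x`, which lies in the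
convex closure, would leave it at once. -/
theorem IsOuterUnitNormal.inner_sub_nonpos (h : IsOuterUnitNormal Ω s v) (hconv : Convex ℝ Ω)
    (hs : s ∈ closure Ω) {x : Euc n} (hx : x ∈ closure Ω) : ⟪v, x - s⟫ ≤ 0 := by
  by_contra! hlt
  have h1 : ∀ᶠ t in 𝓝[>] (0 : ℝ), t < 1 := nhdsWithin_le_nhds (gt_mem_nhds one_pos)
  obtain ⟨t, ht, ht1, ht0⟩ :=
    (((h.2 (x - s)).2 hlt).and (h1.and self_mem_nhdsWithin)).exists
  exact ht (hconv.closure.add_smul_sub_mem hs hx ⟨(le_of_lt ht0), ht1.le⟩)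

end Normal

/-- If the chord of `c` has nonnegative product with the chord of `f`, so do the derivatives. -/
theorem inner_deriv_nonneg {E : Type*} [NormedAddCommGroup E] [InnerProductSpace ℝ E]
    {f c : ℝ → E} {f' c' : E} (hf : HasDerivAt f f' 0) (hc : HasDerivAt c c' 0)
    (h : ∀ᶠ t in 𝓝 (0 : ℝ), 0 ≤ ⟪f t - f 0, c t - c 0⟫) : 0 ≤ ⟪f', c'⟫ := by
  have h1 := (hasDerivAt_iff_tendsto_slope_zero.1 hf).inner (𝕜 := ℝ)
    (hasDerivAt_iff_tendsto_slope_zero.1 hc)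
  refine ge_of_tendsto h1 ?_
  filter_upwards [nhdsWithin_le_nhds h] with t ht
  rw [zero_add, real_inner_smul_left, real_inner_smul_right, ← mul_assoc]
  exact mul_nonneg (mul_self_nonneg _) ht

/-! ### Boundary patches -/

theorem coe_orthogonalProjectionOnto_span_singleton {n : ℕ} {e : Euc n} (he : ‖e‖ = 1)
    (w : Euc n) :
    ((Submodule.span ℝ {e})ᗮ.orthogonalProjectionOnto w : Euc n) = w - ⟪e, w⟫ • e := by
  rw [← Submodule.starProjection_apply, Submodule.starProjection_orthogonal_val,
    Submodule.starProjection_unit_singleton ℝ he]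

/-- A parametrization `Ψ` of the part of `∂Ω` in a neighbourhood `V` of the point `s₀` by a region
of the tangent plane at `s₀`, whose derivative at the point corresponding to `s₀` is the inclusion
of the tangent plane; `N` is the outer unit normal along the parametrization. -/
structure BoundaryPatch {n : ℕ} (Ω : Set (Euc n)) (s₀ v : Euc n) where
  /-- the parametrization -/
  Ψ : (Submodule.span ℝ {v})ᗮ → Euc n
  /-- the unit normal -/
  N : (Submodule.span ℝ {v})ᗮ → Euc n
  /-- the coordinates -/
  Q : Euc n →L[ℝ] (Submodule.span ℝ {v})ᗮ
  /-- the neighbourhood -/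
  V : Set (Euc n)
  norm_v : ‖v‖ = 1
  isOpen_V : IsOpen V
  mem_V : s₀ ∈ V
  contDiff_Ψ : ContDiff ℝ 1 Ψ
  continuous_N : Continuous N
  Q_Ψ : ∀ z, Q (Ψ z) = z
  mem_frontier_iff : ∀ s ∈ V, s ∈ frontier Ω ↔ Ψ (Q s) = s
  isOuterUnitNormal : ∀ z, Ψ z ∈ V → IsOuterUnitNormal Ω (Ψ z) (N z)
  norm_N : ∀ z, ‖N z‖ = 1
  inner_N : ∀ z w, ⟪N z, fderiv ℝ Ψ z w⟫ = 0
  ae_differentiableAt : ∀ᵐ z, DifferentiableAt ℝ N z ∧ DifferentiableAt ℝ (fderiv ℝ Ψ) z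
  fderiv_Ψ : fderiv ℝ Ψ (Q s₀) = (Submodule.span ℝ {v})ᗮ.subtypeL
  N_Q : N (Q s₀) = v

/-! ### Domains below a graph and their normals -/

section Graph

variable {n : ℕ} {Ω : Set (Euc n)} {s₀ e : Euc n} {K : Submodule ℝ (Euc n)} {g : K → ℝ} {r : ℝ}

/-- The points strictly above the graph form an open set that misses `Ω` inside the ball, while any
downward shift of a graph point enters `Ω`. -/
theorem mem_frontier_iff_of_graph (hopen : IsOpen Ω) (hK : K = (Submodule.span ℝ {e})ᗮ) (he : ‖e‖ = 1) (hg : Continuous g)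
    (h : ∀ x ∈ Metric.ball s₀ r,
      (x ∈ Ω ↔ ⟪x, e⟫ < g (K.orthogonalProjectionOnto x)))
    {x : Euc n} (hx : x ∈ Metric.ball s₀ r) :
    x ∈ frontier Ω ↔ ⟪x, e⟫ = g (K.orthogonalProjectionOnto x) := by
  rw [hopen.frontier_eq]
  constructor
  · rintro ⟨h1, h2⟩
    rw [h x hx, not_lt] at h2
    refine le_antisymm ?_ h2
    by_contra! h3
    have h4 : IsOpen {y : Euc n | g (K.orthogonalProjectionOnto y) < ⟪y, e⟫} :=
      isOpen_lt (by fun_prop) (by fun_prop)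
    obtain ⟨y, ⟨hy1, hy2⟩, hy3⟩ := mem_closure_iff.1 h1 _ (h4.inter Metric.isOpen_ball) ⟨h3, hx⟩
    exact lt_asymm hy1 ((h y hy2).1 hy3)
  · intro h1
    refine ⟨?_, fun h2 => ((h x hx).1 h2).ne h1⟩
    have h2 : Tendsto (fun t : ℝ => x - t • e) (𝓝[>] 0) (𝓝 x) := by
      have : Continuous fun t : ℝ => x - t • e := by fun_prop
      simpa using (this.tendsto 0).mono_left (nhdsWithin_le_nhds (s := Ioi 0))
    refine mem_closure_of_tendsto h2 ?_
    filter_upwards [h2.eventually (Metric.isOpen_ball.mem_nhds hx), self_mem_nhdsWithin]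
      with t ht ht0
    rw [h _ ht]
    have h3 : K.orthogonalProjectionOnto (x - t • e) =
        K.orthogonalProjectionOnto x := by
      subst hK
      rw [map_sub, map_smul, Submodule.orthogonalProjectionOnto_orthogonalComplement_singleton_eq_zero,
        smul_zero, sub_zero]
    rw [h3, ← h1, inner_sub_left, real_inner_smul_left, real_inner_self_eq_norm_sq, he]
    have : (0 : ℝ) < t := ht0
    linarith

theorem inner_coe_gradient (y : K) (w : Euc n) :
    ⟪((gradient g y : K) : Euc n), w⟫ =
      fderiv ℝ g y (K.orthogonalProjectionOnto w) := by
  rw [← toDual_gradient, InnerProductSpace.toDual_apply_apply,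
    Submodule.inner_orthogonalProjectionOnto_eq_of_mem_left]

/-- Near `s₀` the domain is the sublevel set `{q < 0}` of `q(x) = ⟪x, e⟫ - g(Px)`, whose gradient is
`m`; the slope of `q` along a line decides on which side it continues. -/
theorem isOuterUnitNormal_of_graph (hopen : IsOpen Ω) (hK : K = (Submodule.span ℝ {e})ᗮ) (he : ‖e‖ = 1) (hg : ContDiff ℝ 1 g)
    (h : ∀ x ∈ Metric.ball s₀ r,
      (x ∈ Ω ↔ ⟪x, e⟫ < g (K.orthogonalProjectionOnto x)))
    {x : Euc n} (hx : x ∈ Metric.ball s₀ r)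
    (hxf : ⟪x, e⟫ = g (K.orthogonalProjectionOnto x))
    {m : Euc n} (hm : m = e - (gradient g (K.orthogonalProjectionOnto x) : K))
    (hm0 : m ≠ 0) :
    IsOuterUnitNormal Ω x (‖m‖⁻¹ • m) := by
  set P := K.orthogonalProjectionOnto with hP
  refine ⟨by rw [norm_smul, norm_inv, norm_norm, inv_mul_cancel₀ (norm_ne_zero_iff.2 hm0)], ?_⟩
  intro w
  have hmp : 0 < ‖m‖⁻¹ := inv_pos.2 (norm_pos_iff.2 hm0)
  set q : ℝ → ℝ := fun t => ⟪x + t • w, e⟫ - g (P (x + t • w)) with hq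
  have hq0 : q 0 = 0 := by simp [hq, hxf]
  have hline : HasDerivAt (fun t : ℝ => x + t • w) w 0 := by
    simpa using ((hasDerivAt_id (0 : ℝ)).smul_const w).const_add x
  have hqd : HasDerivAt q ⟪m, w⟫ 0 := by
    have h1 : HasDerivAt (fun t : ℝ => P (x + t • w)) (P w) 0 :=
      P.hasFDerivAt.comp_hasDerivAt 0 hline
    have h2 : HasDerivAt (fun t : ℝ => g (P (x + t • w))) (fderiv ℝ g (P x) (P w)) 0 := by
      have h3 := ((hg.differentiable (by norm_num)) (P (x + (0 : ℝ) • w))).hasFDerivAt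
      have := h3.comp_hasDerivAt 0 h1
      rwa [zero_smul, add_zero] at this
    have h4 : HasDerivAt (fun t : ℝ => ⟪x + t • w, e⟫) ⟪w, e⟫ 0 := by
      simpa using hline.inner ℝ (hasDerivAt_const (0 : ℝ) e)
    have h5 := h4.sub h2
    suffices ⟪m, w⟫ = ⟪w, e⟫ - fderiv ℝ g (P x) (P w) by rw [this]; exact h5
    rw [hm, inner_sub_left, inner_coe_gradient, real_inner_comm]
  have hslope := (hasDerivAt_iff_tendsto_slope_zero.1 hqd).mono_left
    (nhdsWithin_mono (0 : ℝ) (fun t (ht : t ∈ Ioi (0 : ℝ)) => ne_of_gt ht))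
  simp only [zero_add, hq0, sub_zero, smul_eq_mul] at hslope
  have hball : ∀ᶠ t in 𝓝[>] (0 : ℝ), x + t • w ∈ Metric.ball s₀ r := by
    have := hline.continuousAt.eventually (Metric.isOpen_ball.mem_nhds (by simpa using hx))
    exact nhdsWithin_le_nhds this
  constructor
  · intro hw
    rw [real_inner_smul_left] at hw
    have hw' : ⟪m, w⟫ < 0 := by
      by_contra! h0
      exact absurd hw (not_lt.2 (mul_nonneg hmp.le h0))
    filter_upwards [hball, hslope.eventually (gt_mem_nhds hw'), self_mem_nhdsWithin]
      with t ht ht1 ht0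
    rw [h _ ht, ← sub_neg]
    exact (mul_neg_iff.1 ht1).resolve_right (fun h => lt_asymm h.1 (inv_pos.2 ht0)) |>.2
  · intro hw
    rw [real_inner_smul_left] at hw
    have hw' : 0 < ⟪m, w⟫ := pos_of_mul_pos_right hw hmp.le
    filter_upwards [hball, hslope.eventually (lt_mem_nhds hw'), self_mem_nhdsWithin]
      with t ht ht1 ht0 hcl
    have h3 : 0 < q t := pos_of_mul_pos_right ht1 (inv_pos.2 ht0).le
    have h4 : x + t • w ∉ Ω := fun h5 => by
      have := (h _ ht).1 h5
      simp only [hq] at h3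
      linarith
    have h5 : x + t • w ∈ frontier Ω := by
      rw [hopen.frontier_eq]
      exact ⟨hcl, h4⟩
    rw [mem_frontier_iff_of_graph hopen hK he hg.continuous h ht] at h5
    simp only [hq] at h3
    linarith

end Graph

/-- Normalization is Lipschitz outside the unit ball. -/
theorem LipschitzWith.normalize {X E : Type*} [PseudoEMetricSpace X] [NormedAddCommGroup E]
    [NormedSpace ℝ E] {C : ℝ≥0} {f : X → E} (hf : LipschitzWith C f) (h1 : ∀ x, 1 ≤ ‖f x‖) :
    LipschitzWith (2 * C) fun x => ‖f x‖⁻¹ • f x := by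
  have h2 : LipschitzOnWith 2 (fun y : E => ‖y‖⁻¹ • y) {y | 1 ≤ ‖y‖} := by
    refine LipschitzOnWith.of_dist_le_mul fun x hx y hy => ?_
    have hx' : 1 ≤ ‖x‖ := hx
    have hy' : 1 ≤ ‖y‖ := hy
    have hx0 : 0 < ‖x‖ := by linarith
    have hy0 : 0 < ‖y‖ := by linarith
    rw [dist_eq_norm, dist_eq_norm]
    have h3 : ‖x‖⁻¹ • x - ‖y‖⁻¹ • y = ‖x‖⁻¹ • (x - y) + (‖x‖⁻¹ - ‖y‖⁻¹) • y := by
      module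
    have h4 : ‖(‖x‖⁻¹ - ‖y‖⁻¹) • y‖ ≤ ‖x - y‖ := by
      rw [norm_smul, Real.norm_eq_abs, inv_sub_inv hx0.ne' hy0.ne', abs_div, abs_mul, abs_norm,
        abs_norm, div_mul_eq_mul_div, mul_div_mul_right _ _ hy0.ne', abs_sub_comm]
      exact (div_le_self (abs_nonneg _) hx').trans (abs_norm_sub_norm_le x y)
    have h5 : ‖‖x‖⁻¹ • (x - y)‖ ≤ ‖x - y‖ := by
      rw [norm_smul, norm_inv, norm_norm]
      exact mul_le_of_le_one_left (norm_nonneg _) (inv_le_one_of_one_le₀ hx')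
    rw [h3]
    calc _ ≤ _ := norm_add_le _ _
      _ ≤ ((2 : ℝ≥0) : ℝ) * ‖x - y‖ := by
        rw [NNReal.coe_ofNat]
        linarith
  have h3 := h2.comp (hf.lipschitzOnWith (s := univ)) (fun x _ => h1 x)
  rwa [lipschitzOnWith_univ] at h3

/-- The graph `y ↦ y + g(y) e` is reparametrized by the tangent plane at `s₀` through the projection
along `e`. This turns its derivative at `s₀` into the inclusion, which makes small patches almost
isometric. -/
theorem exists_boundaryPatch_of_graph {n : ℕ} {Ω : Set (Euc n)} (hopen : IsOpen Ω)
    {s₀ e : Euc n} {K : Submodule ℝ (Euc n)} {g : K → ℝ} {r : ℝ} {C : ℝ≥0}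
    (hK : K = (Submodule.span ℝ {e})ᗮ) (he : ‖e‖ = 1) (hg : ContDiff ℝ 1 g)
    (hgL : LipschitzWith C (fderiv ℝ g)) (hr : 0 < r)
    (hΩ : ∀ x ∈ Metric.ball s₀ r, (x ∈ Ω ↔ ⟪x, e⟫ < g (K.orthogonalProjectionOnto x))) :
    ∃ v, Nonempty (BoundaryPatch Ω s₀ v) := by
  set P : Euc n →L[ℝ] K := K.orthogonalProjectionOnto with hP
  have hPK : ∀ y : K, P (y : Euc n) = y := fun y => K.orthogonalProjectionOnto_mem_subspace_eq_self y
  have hPe : P e = 0 := by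
    subst hK
    exact Submodule.orthogonalProjectionOnto_orthogonalComplement_singleton_eq_zero e
  have hPc : ∀ w, (P w : Euc n) = w - ⟪e, w⟫ • e := by
    subst hK
    exact coe_orthogonalProjectionOnto_span_singleton he
  have hKe : ∀ y : K, ⟪(y : Euc n), e⟫ = 0 := fun y =>
    Submodule.mem_orthogonal_singleton_iff_inner_left.1 (hK ▸ y.2)
  have heK : ∀ y : K, ⟪e, (y : Euc n)⟫ = 0 := fun y => by rw [real_inner_comm, hKe]
  have hee : ⟪e, e⟫ = 1 := by rw [real_inner_self_eq_norm_sq, he]; norm_num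
  set m : K → Euc n := fun y => e - (gradient g y : K) with hm
  have hme : ∀ y, ⟪m y, e⟫ = 1 := fun y => by
    simp only [hm, inner_sub_left, hee, hKe, sub_zero]
  -- The normal `m` has `e`-component `1`, so normalizing it keeps it Lipschitz.
  have hm1 : ∀ y, 1 ≤ ‖m y‖ := fun y => by
    have := real_inner_le_norm (m y) e
    rwa [hme, he, mul_one] at this
  have hm0 : ∀ y, m y ≠ 0 := fun y => norm_pos_iff.1 (zero_lt_one.trans_le (hm1 y))
  have hmL : LipschitzWith C m := by
    have h1 : LipschitzWith C (gradient g) := by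
      have := (InnerProductSpace.toDual ℝ K).symm.lipschitz.comp hgL
      rwa [one_mul] at this
    refine LipschitzWith.of_dist_le_mul fun x y => ?_
    rw [hm, dist_sub_left]
    exact h1.dist_le_mul x y
  have hmd : ∀ y w, ⟪m y, w⟫ = ⟪e, w⟫ - fderiv ℝ g y (P w) := fun y w => by
    simp only [hm, inner_sub_left]
    rw [inner_coe_gradient]
  set ν : K → Euc n := fun y => ‖m y‖⁻¹ • m y with hν
  have hνL : LipschitzWith (2 * C) ν := LipschitzWith.normalize hmL hm1
  have hν1 : ∀ y, ‖ν y‖ = 1 := fun y => by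
    rw [hν]
    simp only
    rw [norm_smul, norm_inv, norm_norm, inv_mul_cancel₀ (norm_ne_zero_iff.2 (hm0 y))]
  set y₀ := P s₀ with hy₀
  set v := ν y₀ with hv
  set T := (Submodule.span ℝ {v})ᗮ with hT
  have hTm : ∀ w : Euc n, w ∈ T ↔ ⟪m y₀, w⟫ = 0 := fun w => by
    rw [hT, Submodule.mem_orthogonal_singleton_iff_inner_right, hv, hν]
    simp only
    rw [real_inner_smul_left, mul_eq_zero, or_iff_right]
    exact inv_ne_zero (norm_ne_zero_iff.2 (hm0 _))
  set ψ : K → Euc n := fun y => y + g y • e with hψ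
  set Dψ : K → K →L[ℝ] Euc n := fun y => K.subtypeL + (fderiv ℝ g y).smulRight e with hDψ
  have hψd : ∀ y, HasFDerivAt ψ (Dψ y) y := fun y =>
    K.subtypeL.hasFDerivAt.add
      (((hg.differentiable (by norm_num)) y).hasFDerivAt.smul_const e)
  have hDψL : LipschitzWith (1 * C) Dψ := by
    refine LipschitzWith.of_dist_le_mul fun x y => ?_
    have h1 : Dψ x - Dψ y = (fderiv ℝ g x - fderiv ℝ g y).smulRight e := by
      ext1 w
      simp [hDψ, sub_smul]
    rw [dist_eq_norm, h1, ContinuousLinearMap.norm_smulRight_apply, he, mul_one, one_mul]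
    exact (dist_eq_norm (fderiv ℝ g x) (fderiv ℝ g y)).symm.le.trans (hgL.dist_le_mul x y)
  set ι : T →L[ℝ] K := P ∘L T.subtypeL with hι
  -- This is the projection onto the tangent plane `T` along `e`. It depends on `P w` only, hence
  -- does not distinguish `z ∈ T` from the graph point above or below it.
  set Q₀ : Euc n →L[ℝ] Euc n := Dψ y₀ ∘L P with hQ₀
  have hQ₀T : ∀ w, Q₀ w ∈ T := fun w => by
    rw [hTm, hmd]
    simp only [hQ₀, hDψ, ContinuousLinearMap.comp_apply, add_apply,
      Submodule.subtypeL_apply, ContinuousLinearMap.smulRight_apply, map_add, map_smul, hPK, hPe,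
      smul_zero, add_zero, inner_add_right, real_inner_smul_right, hee, heK]
    ring
  set Q : Euc n →L[ℝ] T := Q₀.codRestrict T hQ₀T with hQ
  have hQc : ∀ w, (Q w : Euc n) = P w + fderiv ℝ g y₀ (P w) • e := fun w => by
    simp [hQ, hQ₀, hDψ]
  have hPQ : ∀ w, P (Q w) = P w := fun w => by
    rw [hQc, map_add, map_smul, hPK, hPe, smul_zero, add_zero]
  have hPψ : ∀ y, P (ψ y) = y := fun y => by
    simp [hψ, hPK, hPe]
  have hQT : ∀ z : T, Q (z : Euc n) = z := fun z => by
    have h1 := (hTm z).1 z.2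
    rw [hmd, sub_eq_zero] at h1
    apply Subtype.ext
    rw [hQc, ← h1, hPc]
    abel
  have hQeq : ∀ w w' : Euc n, P w = P w' → Q w = Q w' := fun w w' h => by
    apply Subtype.ext
    rw [hQc, hQc, h]
  have hderiv : ∀ z, HasFDerivAt (fun z : T => ψ (ι z)) (Dψ (ι z) ∘L ι) z := fun z =>
    (hψd (ι z)).comp z ι.hasFDerivAt
  have hfderiv : fderiv ℝ (fun z : T => ψ (ι z)) = fun z => Dψ (ι z) ∘L ι :=
    funext fun z => (hderiv z).fderiv
  have hball : ∀ z : T, ψ (ι z) ∈ Metric.ball s₀ r →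
      IsOuterUnitNormal Ω (ψ (ι z)) (ν (ι z)) := fun z hz => by
    refine isOuterUnitNormal_of_graph hopen hK he hg hΩ hz ?_ ?_ (hm0 _)
    · change _ = g (P _)
      rw [hPψ, hψ]
      simp only [inner_add_left, real_inner_smul_left, hee, hKe, zero_add, mul_one]
    · change _ = e - ((gradient g (P _) : K) : Euc n)
      rw [hPψ]
  have hs₀' : ι (Q s₀) = y₀ := hPQ s₀
  refine ⟨v, ⟨⟨fun z => ψ (ι z), fun z => ν (ι z), Q, Metric.ball s₀ r, hν1 _, Metric.isOpen_ball,
    Metric.mem_ball_self hr, ?_, hνL.continuous.comp ι.continuous, ?_, ?_, hball, fun z => hν1 _,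
    ?_, ?_, ?_, ?_⟩⟩⟩
  · have : ContDiff ℝ 1 ψ := K.subtypeL.contDiff.add (hg.smul contDiff_const)
    exact this.comp ι.contDiff
  · intro z
    conv_rhs => rw [← hQT z]
    exact hQeq _ _ (hPψ _)
  · intro s hs
    rw [mem_frontier_iff_of_graph hopen hK he hg.continuous hΩ hs]
    have h1 : ι (Q s) = P s := hPQ s
    change ⟪s, e⟫ = g (P s) ↔ ψ (ι (Q s)) = s
    rw [h1, hψ]
    simp only
    rw [hPc, sub_add_eq_add_sub, sub_eq_iff_eq_add, add_right_inj, real_inner_comm]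
    constructor
    · intro h; rw [h]
    · intro h
      have h2 : ⟪g (P s) • e, e⟫ = ⟪⟪e, s⟫ • e, e⟫ := by rw [h]
      rw [real_inner_smul_left, real_inner_smul_left, hee, mul_one, mul_one] at h2
      exact h2.symm
  · intro z w
    rw [hfderiv]
    simp only [hν, real_inner_smul_left]
    rw [hmd]
    simp only [hDψ, ContinuousLinearMap.comp_apply, add_apply,
      Submodule.subtypeL_apply, ContinuousLinearMap.smulRight_apply, map_add, map_smul, hPK, hPe,
      smul_zero, add_zero, inner_add_right, real_inner_smul_right, hee, heK]
    ring
  -- The normal and the derivative of the parametrization are Lipschitz, so Rademacher's theorem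
  -- applies to both.
  · have h1 : LipschitzWith (2 * C * ‖ι‖₊) fun z => ν (ι z) := hνL.comp ι.lipschitz
    have h2 : LipschitzWith (1 * C * ‖ι‖₊) fun z => Dψ (ι z) := hDψL.comp ι.lipschitz
    filter_upwards [h1.ae_differentiableAt (μ := volume), h2.ae_differentiableAt (μ := volume)]
      with z hz1 hz2
    refine ⟨hz1, ?_⟩
    rw [hfderiv]
    exact hz2.clm_comp (differentiableAt_const _)
  · rw [hfderiv]
    ext1 z
    simp only [hs₀']
    change Q₀ (z : Euc n) = z
    exact congrArg Subtype.val (hQT z)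
  · simp only [hs₀']
    rfl

theorem exists_boundaryPatch {n : ℕ} {Ω : Set (Euc n)} (hopen : IsOpen Ω)
    (hC11 : HasC11Boundary Ω) {s₀ : Euc n} (hs₀ : s₀ ∈ frontier Ω) :
    ∃ v, Nonempty (BoundaryPatch Ω s₀ v) := by
  obtain ⟨e, g, C, r, he, hg, hgL, hr, hΩ⟩ := hC11 s₀ hs₀
  exact exists_boundaryPatch_of_graph hopen rfl he hg hgL hr hΩ

end ExteriorSteklov

namespace ExteriorSteklov

/-! ### The shape operator and the Jacobian of normal coordinates -/

theorem one_le_of_norm_eq_one {n : ℕ} {w : Euc n} (hw : ‖w‖ = 1) : 1 ≤ n := by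
  by_contra! h
  have : n = 0 := by omega
  subst this
  rw [Subsingleton.elim w 0, norm_zero] at hw
  exact zero_ne_one hw

theorem finrank_orthogonal_of_norm_eq_one {n : ℕ} {w : Euc n} (hw : ‖w‖ = 1) :
    Module.finrank ℝ (Submodule.span ℝ {w})ᗮ = n - 1 := by
  have hn := one_le_of_norm_eq_one hw
  have : Fact (Module.finrank ℝ (Euc n) = n - 1 + 1) := ⟨by
    rw [finrank_euclideanSpace_fin]; omega⟩
  exact Submodule.finrank_orthogonal_span_singleton (by
    rintro rfl
    simp at hw)

namespace BoundaryPatch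

variable {n : ℕ} {Ω : Set (Euc n)} {s₀ v : Euc n} (p : BoundaryPatch Ω s₀ v)
  {z : (Submodule.span ℝ {v})ᗮ}

theorem mem_frontier (hz : p.Ψ z ∈ p.V) : p.Ψ z ∈ frontier Ω := by
  rw [p.mem_frontier_iff _ hz, p.Q_Ψ]

theorem outerNormal_eq (hz : p.Ψ z ∈ p.V) : outerNormal Ω (p.Ψ z) = p.N z :=
  (p.isOuterUnitNormal z hz).outerNormal_eq

theorem hasFDerivAt_Ψ (z : (Submodule.span ℝ {v})ᗮ) : HasFDerivAt p.Ψ (fderiv ℝ p.Ψ z) z :=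
  ((p.contDiff_Ψ.differentiable (by norm_num)) z).hasFDerivAt

/-- On the boundary near `Ψ z` the Gauss map is `N ∘ Q`, which is differentiable in the ambient
space. -/
theorem hasFDerivWithinAt_outerNormal (hz : p.Ψ z ∈ p.V) (hN : DifferentiableAt ℝ p.N z) :
    HasFDerivWithinAt (outerNormal Ω) (fderiv ℝ p.N z ∘L p.Q) (frontier Ω) (p.Ψ z) := by
  have h1 : HasFDerivAt (fun s => p.N (p.Q s)) (fderiv ℝ p.N z ∘L p.Q) (p.Ψ z) := by
    have h2 : HasFDerivAt p.N (fderiv ℝ p.N z) (p.Q (p.Ψ z)) := by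
      rw [p.Q_Ψ]
      exact hN.hasFDerivAt
    exact h2.comp _ p.Q.hasFDerivAt
  refine h1.hasFDerivWithinAt.congr_of_eventuallyEq ?_ ?_
  · filter_upwards [self_mem_nhdsWithin, nhdsWithin_le_nhds (p.isOpen_V.mem_nhds hz)] with s hs hsV
    have h2 := (p.mem_frontier_iff s hsV).1 hs
    have h3 := p.outerNormal_eq (z := p.Q s) (by rwa [h2])
    rwa [h2] at h3
  · rw [p.outerNormal_eq hz, p.Q_Ψ]

theorem Q_fderiv_Ψ (z w : (Submodule.span ℝ {v})ᗮ) : p.Q (fderiv ℝ p.Ψ z w) = w := by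
  have h1 := p.Q.hasFDerivAt.comp z (p.hasFDerivAt_Ψ z)
  have h2 : (p.Q ∘ p.Ψ) = id := funext p.Q_Ψ
  rw [h2] at h1
  exact congrArg (fun L : (Submodule.span ℝ {v})ᗮ →L[ℝ] (Submodule.span ℝ {v})ᗮ => L w)
    (h1.unique (hasFDerivAt_id z))

/-- By a dimension count the range of the derivative of `Ψ` is all of the tangent space, so its left
inverse `Q` is two-sided there. -/
theorem fderiv_Ψ_Q {x : Euc n} (hx : ⟪p.N z, x⟫ = 0) : fderiv ℝ p.Ψ z (p.Q x) = x := by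
  have h1 : (fderiv ℝ p.Ψ z).toLinearMap.range = (Submodule.span ℝ {p.N z})ᗮ := by
    refine Submodule.eq_of_le_of_finrank_eq ?_ ?_
    · rintro _ ⟨w, rfl⟩
      exact Submodule.mem_orthogonal_singleton_iff_inner_right.2 (p.inner_N z w)
    · rw [LinearMap.finrank_range_of_inj, finrank_orthogonal_of_norm_eq_one p.norm_v,
        finrank_orthogonal_of_norm_eq_one (p.norm_N z)]
      exact Function.LeftInverse.injective (g := p.Q) (p.Q_fderiv_Ψ z)
  have h2 : x ∈ (fderiv ℝ p.Ψ z).toLinearMap.range := by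
    rw [h1]
    exact Submodule.mem_orthogonal_singleton_iff_inner_right.2 hx
  obtain ⟨w, rfl⟩ := h2
  exact congrArg (fderiv ℝ p.Ψ z) (p.Q_fderiv_Ψ z w)

theorem inner_fderiv_N (hN : DifferentiableAt ℝ p.N z) (w : (Submodule.span ℝ {v})ᗮ) :
    ⟪p.N z, fderiv ℝ p.N z w⟫ = 0 := by
  have h1 := hN.hasFDerivAt.inner ℝ hN.hasFDerivAt
  have h2 : (fun z => ⟪p.N z, p.N z⟫) = fun _ => (1 : ℝ) := by
    ext z
    rw [real_inner_self_eq_norm_sq, p.norm_N, one_pow]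
  rw [h2] at h1
  have h3 := congrArg (fun L : (Submodule.span ℝ {v})ᗮ →L[ℝ] ℝ => L w)
    (h1.unique (hasFDerivAt_const (1 : ℝ) z))
  simp only [ContinuousLinearMap.comp_apply, ContinuousLinearMap.prod_apply,
    fderivInnerCLM_apply, zero_apply] at h3
  rw [real_inner_comm (p.N z)] at h3
  linarith

/-- Differentiating `⟪N, ∂Ψ⟫ = 0` turns both sides into `-⟪N, ∂²Ψ⟫`, and second derivatives commute
wherever the first derivative is differentiable. -/
theorem inner_fderiv_symm (hN : DifferentiableAt ℝ p.N z)
    (hΨ : DifferentiableAt ℝ (fderiv ℝ p.Ψ) z) (w w' : (Submodule.span ℝ {v})ᗮ) :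
    ⟪fderiv ℝ p.N z w, fderiv ℝ p.Ψ z w'⟫ = ⟪fderiv ℝ p.N z w', fderiv ℝ p.Ψ z w⟫ := by
  have key : ∀ w w' : (Submodule.span ℝ {v})ᗮ, ⟪fderiv ℝ p.N z w, fderiv ℝ p.Ψ z w'⟫ =
      -⟪p.N z, fderiv ℝ (fderiv ℝ p.Ψ) z w w'⟫ := fun w w' => by
    have h0 : HasFDerivAt (fun z => fderiv ℝ p.Ψ z w')
        ((ContinuousLinearMap.apply ℝ (Euc n) w') ∘L fderiv ℝ (fderiv ℝ p.Ψ) z) z :=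
      (ContinuousLinearMap.apply ℝ (Euc n) w').hasFDerivAt.comp z hΨ.hasFDerivAt
    have h1 := hN.hasFDerivAt.inner ℝ h0
    have h2 : (fun z => ⟪p.N z, fderiv ℝ p.Ψ z w'⟫) = fun _ => (0 : ℝ) := by
      ext z
      exact p.inner_N z w'
    rw [h2] at h1
    have h3 := congrArg (fun L : (Submodule.span ℝ {v})ᗮ →L[ℝ] ℝ => L w)
      (h1.unique (hasFDerivAt_const (0 : ℝ) z))
    simp only [ContinuousLinearMap.comp_apply, ContinuousLinearMap.prod_apply,
      fderivInnerCLM_apply, zero_apply, ContinuousLinearMap.apply_apply] at h3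
    linarith
  rw [key, key, second_derivative_symmetric (p.hasFDerivAt_Ψ) hΨ.hasFDerivAt]

/-- The shape operator is diagonal in some orthonormal basis of the tangent space. -/
theorem exists_eigenbasis (hN : DifferentiableAt ℝ p.N z)
    (hΨ : DifferentiableAt ℝ (fderiv ℝ p.Ψ) z) :
    ∃ (κ : Fin (n - 1) → ℝ) (e : Fin (n - 1) → Euc n), Orthonormal ℝ e ∧
      (∀ j, ⟪p.N z, e j⟫ = 0) ∧ ∀ j, fderiv ℝ p.N z (p.Q (e j)) = κ j • e j := by
  set K := (Submodule.span ℝ {p.N z})ᗮ with hK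
  have hmem : ∀ x : K, ⟪p.N z, (x : Euc n)⟫ = 0 := fun x =>
    Submodule.mem_orthogonal_singleton_iff_inner_right.1 x.2
  let S : K →ₗ[ℝ] K := ((fderiv ℝ p.N z ∘L p.Q ∘L K.subtypeL).codRestrict K fun x =>
    Submodule.mem_orthogonal_singleton_iff_inner_right.2 (p.inner_fderiv_N hN _)).toLinearMap
  have hS : ∀ x : K, (S x : Euc n) = fderiv ℝ p.N z (p.Q x) := fun x => rfl
  have hsymm : S.IsSymmetric := fun x y => by
    rw [Submodule.coe_inner, Submodule.coe_inner, hS, hS]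
    have h1 := p.inner_fderiv_symm hN hΨ (p.Q x) (p.Q y)
    rw [p.fderiv_Ψ_Q (hmem x), p.fderiv_Ψ_Q (hmem y)] at h1
    rw [h1, real_inner_comm]
  have hrank := finrank_orthogonal_of_norm_eq_one (p.norm_N z)
  refine ⟨hsymm.eigenvalues hrank, fun j => hsymm.eigenvectorBasis hrank j, ?_, fun j => hmem _,
    fun j => ?_⟩
  · exact (hsymm.eigenvectorBasis hrank).orthonormal.comp_linearIsometry K.subtypeₗᵢ
  · have h1 := congrArg Subtype.val (hsymm.apply_eigenvectorBasis hrank j)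
    exact h1

/-- The normal parametrization of the exterior domain, with the factors of the product
identified with the tangent space and the normal line at `s₀`. -/
noncomputable def tubeMap (x : Euc n) : Euc n :=
  p.Ψ ((Submodule.span ℝ {v})ᗮ.orthogonalProjectionOnto x) +
    ⟪v, x⟫ • p.N ((Submodule.span ℝ {v})ᗮ.orthogonalProjectionOnto x)

/-- The derivative of the normal parametrization on the boundary. -/
noncomputable def frame (z : (Submodule.span ℝ {v})ᗮ) : Euc n →L[ℝ] Euc n :=
  fderiv ℝ p.Ψ z ∘L (Submodule.span ℝ {v})ᗮ.orthogonalProjectionOnto +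
    (innerSL ℝ v).smulRight (p.N z)

theorem continuous_frame : Continuous p.frame := by
  have h1 : Continuous (fderiv ℝ p.Ψ) := p.contDiff_Ψ.continuous_fderiv (by norm_num)
  have h2 : Continuous fun z => (innerSL ℝ v).smulRight (p.N z) :=
    ((ContinuousLinearMap.smulRightL ℝ (Euc n) (Euc n) (innerSL ℝ v)).continuous).comp
      p.continuous_N
  exact (h1.clm_comp continuous_const).add h2

/-- With continuity of the frame, this keeps its determinant close to `1` on a small patch. -/
theorem frame_Q : p.frame (p.Q s₀) = ContinuousLinearMap.id ℝ (Euc n) := by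
  ext1 x
  simp only [frame, p.fderiv_Ψ, p.N_Q, add_apply, ContinuousLinearMap.comp_apply,
    ContinuousLinearMap.smulRight_apply, innerSL_apply_apply, Submodule.subtypeL_apply,
    ContinuousLinearMap.id_apply]
  rw [coe_orthogonalProjectionOnto_span_singleton p.norm_v]
  abel

theorem hasFDerivAt_tubeMap {x : Euc n}
    (hN : DifferentiableAt ℝ p.N ((Submodule.span ℝ {v})ᗮ.orthogonalProjectionOnto x)) :
    HasFDerivAt p.tubeMap
      (p.frame ((Submodule.span ℝ {v})ᗮ.orthogonalProjectionOnto x) +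
        ⟪v, x⟫ • (fderiv ℝ p.N ((Submodule.span ℝ {v})ᗮ.orthogonalProjectionOnto x) ∘L
          (Submodule.span ℝ {v})ᗮ.orthogonalProjectionOnto)) x := by
  set P := (Submodule.span ℝ {v})ᗮ.orthogonalProjectionOnto with hP
  have h1 : HasFDerivAt (fun x => p.Ψ (P x)) (fderiv ℝ p.Ψ (P x) ∘L P) x :=
    (p.hasFDerivAt_Ψ (P x)).comp x P.hasFDerivAt
  have h2 : HasFDerivAt (fun x => p.N (P x)) (fderiv ℝ p.N (P x) ∘L P) x :=
    hN.hasFDerivAt.comp x P.hasFDerivAt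
  have h3 : HasFDerivAt (fun x => ⟪v, x⟫) (innerSL ℝ v) x := (innerSL ℝ v).hasFDerivAt
  refine (h1.add (h3.smul h2)).congr_fderiv ?_
  rw [frame]
  abel

/-- Adding `N` to the `e j` gives an orthonormal basis in which `L` is diagonal, with the extra
entry `1`. -/
theorem det_one_add {N : Euc n} (hn : 1 ≤ n) (hN : ‖N‖ = 1) {e : Fin (n - 1) → Euc n}
    (he : Orthonormal ℝ e) (hNe : ∀ j, ⟪N, e j⟫ = 0) {L : Euc n →L[ℝ] Euc n} {μ : Fin (n - 1) → ℝ}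
    (hLN : L N = N) (hLe : ∀ j, L (e j) = μ j • e j) : L.det = ∏ j, μ j := by
  set b : Option (Fin (n - 1)) → Euc n := fun o => o.elim N e with hb
  have hon : Orthonormal ℝ b := by
    refine ⟨fun o => ?_, fun o o' h => ?_⟩
    · cases o with
      | none => exact hN
      | some j => exact he.1 j
    · cases o with
      | none =>
        cases o' with
        | none => exact absurd rfl h
        | some j => exact hNe j
      | some i =>
        cases o' with
        | none => exact (real_inner_comm _ _).trans (hNe i)
        | some j => exact he.2 fun h' => h (congrArg some h')
  have hcard : Fintype.card (Option (Fin (n - 1))) = Module.finrank ℝ (Euc n) := by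
    rw [finrank_euclideanSpace_fin, Fintype.card_option, Fintype.card_fin]
    omega
  let B := basisOfOrthonormalOfCardEqFinrank hon hcard
  have hB : ∀ o, B o = b o := fun o =>
    congrFun (coe_basisOfOrthonormalOfCardEqFinrank hon hcard) o
  set μ' : Option (Fin (n - 1)) → ℝ := fun o => o.elim 1 μ with hμ'
  have hL : ∀ o, L (B o) = μ' o • B o := fun o => by
    rw [hB]
    cases o with
    | none => simpa [hμ', hb] using hLN
    | some j => exact hLe j
  have hM : LinearMap.toMatrix B B L.toLinearMap = Matrix.diagonal μ' := by
    ext i j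
    rw [LinearMap.toMatrix_apply, Matrix.diagonal_apply]
    change B.repr (L (B j)) i = _
    rw [hL, map_smul, Finsupp.smul_apply, B.repr_self, Finsupp.single_apply]
    by_cases h : i = j
    · simp [h]
    · simp [h, Ne.symm h]
  change LinearMap.det L.toLinearMap = _
  rw [← LinearMap.det_toMatrix B, hM, Matrix.det_diagonal, Fintype.prod_option]
  simp [hμ']

/-- The Jacobian determinant of the normal parametrization in terms of the principal
curvatures. -/
theorem det_tubeMap {κ : Fin (n - 1) → ℝ}
    {e : Fin (n - 1) → Euc n} (he : Orthonormal ℝ e) (hNe : ∀ j, ⟪p.N z, e j⟫ = 0)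
    (hκ : ∀ j, fderiv ℝ p.N z (p.Q (e j)) = κ j • e j) (t : ℝ) :
    (p.frame z + t • (fderiv ℝ p.N z ∘L
      (Submodule.span ℝ {v})ᗮ.orthogonalProjectionOnto)).det =
      (∏ j, (1 + t * κ j)) * (p.frame z).det := by
  set P := (Submodule.span ℝ {v})ᗮ.orthogonalProjectionOnto with hP
  -- The shape operator, extended by zero on the normal line. From `A ∘ DΨ = DN` and `A N = 0` the
  -- derivative factors as `(1 + t A) ∘ frame`.
  set A : Euc n →L[ℝ] Euc n := fderiv ℝ p.N z ∘L p.Q ∘L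
    (ContinuousLinearMap.id ℝ (Euc n) - (innerSL ℝ (p.N z)).smulRight (p.N z)) with hA
  have hA' : ∀ x, A x = fderiv ℝ p.N z (p.Q (x - ⟪p.N z, x⟫ • p.N z)) := fun x => by
    simp [hA]
  have hNN : ⟪p.N z, p.N z⟫ = 1 := by rw [real_inner_self_eq_norm_sq, p.norm_N, one_pow]
  have hAN : A (p.N z) = 0 := by rw [hA', hNN, one_smul, sub_self, map_zero, map_zero]
  have hAΨ : ∀ w, A (fderiv ℝ p.Ψ z w) = fderiv ℝ p.N z w := fun w => by
    rw [hA', p.inner_N, zero_smul, sub_zero, p.Q_fderiv_Ψ]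
  have h1 : p.frame z + t • (fderiv ℝ p.N z ∘L P) =
      (ContinuousLinearMap.id ℝ (Euc n) + t • A) ∘L p.frame z := by
    ext1 x
    simp only [frame, add_apply, smul_apply, ContinuousLinearMap.comp_apply,
      ContinuousLinearMap.id_apply, ContinuousLinearMap.smulRight_apply, map_add, map_smul, hAN,
      hAΨ, smul_zero, add_zero, hP]
    abel
  have h2 : (ContinuousLinearMap.id ℝ (Euc n) + t • A).det = ∏ j, (1 + t * κ j) := by
    refine det_one_add (one_le_of_norm_eq_one p.norm_v) (p.norm_N z) he hNe ?_ fun j => ?_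
    · simp [hAN]
    · simp only [add_apply, smul_apply, ContinuousLinearMap.id_apply]
      rw [hA', hNe, zero_smul, sub_zero, hκ, smul_smul, add_smul, one_smul]
  rw [h1, ← h2]
  change LinearMap.det ((ContinuousLinearMap.id ℝ (Euc n) + t • A).toLinearMap ∘ₗ
    (p.frame z).toLinearMap) = _
  rw [LinearMap.det_comp]

end BoundaryPatch

/-- The principal curvatures of a convex domain are nonnegative. -/
theorem HasPrincipalCurvatures.nonneg {n : ℕ} {Ω : Set (Euc n)} (hopen : IsOpen Ω)
    (hconv : Convex ℝ Ω) (hC11 : HasC11Boundary Ω) {s : Euc n} {κ : Fin (n - 1) → ℝ}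
    (h : HasPrincipalCurvatures Ω s κ) (j : Fin (n - 1)) : 0 ≤ κ j := by
  obtain ⟨hs, A, e, hA, he, hne, hAe⟩ := h
  obtain ⟨v, ⟨p⟩⟩ := exists_boundaryPatch hopen hC11 hs
  have hΨQ : p.Ψ (p.Q s) = s := (p.mem_frontier_iff s p.mem_V).1 hs
  have hnorm : outerNormal Ω s = v := by
    have h1 := p.outerNormal_eq (z := p.Q s) (by rw [hΨQ]; exact p.mem_V)
    rwa [hΨQ, p.N_Q] at h1
  have hej : e j ∈ (Submodule.span ℝ {v})ᗮ := by
    rw [Submodule.mem_orthogonal_singleton_iff_inner_right, ← hnorm]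
    exact hne j
  set w : (Submodule.span ℝ {v})ᗮ := ⟨e j, hej⟩ with hw
  -- A curve on the boundary through `s` with velocity `e j`. The supporting hyperplanes at `c t`
  -- and `c 0` make the Gauss map monotone along it, so `⟪A (e j), e j⟫ = κ j` is nonnegative.
  set c : ℝ → Euc n := fun t => p.Ψ (p.Q s + t • w) with hc
  have hc0 : c 0 = s := by simp [hc, hΨQ]
  have hcd : HasDerivAt c (e j) 0 := by
    have h1 : HasDerivAt (fun t : ℝ => p.Q s + t • w) w 0 := by
      simpa using ((hasDerivAt_id (0 : ℝ)).smul_const w).const_add (p.Q s)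
    have h2 : HasFDerivAt p.Ψ ((Submodule.span ℝ {v})ᗮ.subtypeL) (p.Q s + (0 : ℝ) • w) := by
      rw [zero_smul, add_zero, ← p.fderiv_Ψ]
      exact p.hasFDerivAt_Ψ _
    exact h2.comp_hasDerivAt 0 h1
  have hcV : ∀ᶠ t in 𝓝 (0 : ℝ), c t ∈ p.V :=
    hcd.continuousAt.eventually (p.isOpen_V.mem_nhds (by rw [hc0]; exact p.mem_V))
  have hcf : ∀ᶠ t in 𝓝 (0 : ℝ), c t ∈ frontier Ω := by
    filter_upwards [hcV] with t ht using p.mem_frontier ht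
  have hfd : HasDerivAt (fun t => outerNormal Ω (c t)) (A (e j)) 0 := by
    rw [← hasDerivWithinAt_univ] at hcd ⊢
    have h1 : HasFDerivWithinAt (outerNormal Ω) A (frontier Ω) (c 0) := by rwa [hc0]
    have h3 : HasDerivWithinAt c (e j) {t | c t ∈ frontier Ω} 0 := hcd.mono (subset_univ _)
    have h2 := h1.comp_hasDerivWithinAt (0 : ℝ) h3 (fun t ht => ht)
    rw [hasDerivWithinAt_univ]
    exact h2.hasDerivAt hcf
  have hle := inner_deriv_nonneg hfd hcd (by
    filter_upwards [hcV] with t ht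
    have ht0 : c 0 ∈ p.V := by rw [hc0]; exact p.mem_V
    have hN : ∀ t, c t ∈ p.V → IsOuterUnitNormal Ω (c t) (outerNormal Ω (c t)) := fun t ht => by
      have h1 := p.isOuterUnitNormal (p.Q s + t • w) ht
      have h2 := p.outerNormal_eq ht
      rw [← h2] at h1
      exact h1
    have h1 := (hN t ht).inner_sub_nonpos hconv (frontier_subset_closure (p.mem_frontier ht))
      (frontier_subset_closure (p.mem_frontier ht0))
    have h2 := (hN 0 ht0).inner_sub_nonpos hconv (frontier_subset_closure (p.mem_frontier ht0))
      (frontier_subset_closure (p.mem_frontier ht))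
    have h3 : p.Ψ (p.Q s + t • w) = c t := rfl
    have h4 : p.Ψ (p.Q s + (0 : ℝ) • w) = c 0 := rfl
    rw [h4] at h1
    rw [h3] at h2
    rw [← neg_sub, inner_neg_right] at h1
    rw [inner_sub_left]
    linarith)
  rwa [hAe, real_inner_smul_left, real_inner_self_eq_norm_sq, he.1, one_pow, mul_one] at hle

end ExteriorSteklov

namespace ExteriorSteklov

/-! ### The Dirichlet energy in normal coordinates -/

theorem euclideanHausdorffMeasure_image_le {X Y : Type*} [EMetricSpace X] [MeasurableSpace X]
    [BorelSpace X] [EMetricSpace Y] [MeasurableSpace Y] [BorelSpace Y] {f : X → Y} {K : ℝ≥0}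
    {s : Set X} (hf : LipschitzOnWith K f s) (d : ℕ) :
    Measure.euclideanHausdorffMeasure d (f '' s) ≤
      (K : ℝ≥0∞) ^ d * Measure.euclideanHausdorffMeasure d s := by
  simp only [Measure.euclideanHausdorffMeasure_def, Measure.smul_apply, ENNReal.smul_def,
    smul_eq_mul]
  rw [mul_left_comm]
  gcongr
  simpa using hf.hausdorffMeasure_image_le (d := d) (Nat.cast_nonneg d)

/-- Orthogonal coordinates along a unit vector and its orthogonal complement preserve the
volume. -/
theorem measurePreserving_orthogonal_coordinates {n : ℕ} {v : Euc n} (hv : ‖v‖ = 1) :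
    MeasurePreserving (fun x : Euc n =>
      ((Submodule.span ℝ {v})ᗮ.orthogonalProjectionOnto x, ⟪v, x⟫)) volume volume := by
  let K := Submodule.span ℝ {v}
  have h1 := K.orthogonalDecomposition.measurePreserving
  have h2 := WithLp.volume_preserving_ofLp K Kᗮ
  have h3 : MeasurePreserving (Prod.swap : K × Kᗮ → Kᗮ × K) volume volume :=
    Measure.measurePreserving_swap
  have h4 : MeasurePreserving (Prod.map id (LinearIsometryEquiv.toSpanUnitSingleton v hv).symm :
      Kᗮ × K → Kᗮ × ℝ) volume volume :=
    (MeasurePreserving.id volume).prod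
      (LinearIsometryEquiv.toSpanUnitSingleton v hv).symm.measurePreserving
  have h5 := ((h4.comp h3).comp h2).comp h1
  refine (congrArg (fun f => MeasurePreserving f volume volume) ?_).mp h5
  ext1 x
  refine (Prod.ext ?_ ?_).symm
  · simp [K]
  · change ⟪v, x⟫ = (LinearIsometryEquiv.toSpanUnitSingleton v hv).symm _
    rw [LinearIsometryEquiv.eq_symm_apply]
    apply Subtype.ext
    simp only [LinearIsometryEquiv.toSpanUnitSingleton_apply,
      Submodule.orthogonalDecomposition_apply]
    rw [← Submodule.starProjection_apply, Submodule.starProjection_unit_singleton ℝ hv]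

/-- The union of the exterior normal rays that issue from the points of `B`. -/
def tube {n : ℕ} (Ω B : Set (Euc n)) : Set (Euc n) :=
  {x | ∃ s ∈ B, ∃ t : ℝ, 0 < t ∧ x = s + t • outerNormal Ω s}

section Tube

variable {n : ℕ} {Ω : Set (Euc n)}

theorem isOuterUnitNormal_outerNormal (hopen : IsOpen Ω) (hC11 : HasC11Boundary Ω)
    {s : Euc n} (hs : s ∈ frontier Ω) : IsOuterUnitNormal Ω s (outerNormal Ω s) := by
  obtain ⟨v, ⟨p⟩⟩ := exists_boundaryPatch hopen hC11 hs
  have hΨQ : p.Ψ (p.Q s) = s := (p.mem_frontier_iff s p.mem_V).1 hs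
  have hV : p.Ψ (p.Q s) ∈ p.V := by rw [hΨQ]; exact p.mem_V
  have h1 := p.isOuterUnitNormal _ hV
  rw [← p.outerNormal_eq hV, hΨQ] at h1
  exact h1

theorem tube_subset_ext (hopen : IsOpen Ω) (hconv : Convex ℝ Ω) (hC11 : HasC11Boundary Ω) :
    tube Ω (frontier Ω) ⊆ ext Ω := by
  rintro x ⟨s, hs, t, ht, rfl⟩ hx
  have h := isOuterUnitNormal_outerNormal hopen hC11 hs
  have h1 := h.inner_sub_nonpos hconv (frontier_subset_closure hs) hx
  rw [add_sub_cancel_left, real_inner_smul_right, real_inner_self_eq_norm_sq, h.1] at h1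
  linarith

/-- Exterior normal rays of a convex domain do not meet. -/
theorem eq_of_add_smul_outerNormal_eq (hopen : IsOpen Ω) (hconv : Convex ℝ Ω)
    (hC11 : HasC11Boundary Ω) {s s' : Euc n} (hs : s ∈ frontier Ω) (hs' : s' ∈ frontier Ω)
    {t t' : ℝ} (ht : 0 < t) (ht' : 0 < t')
    (h : s + t • outerNormal Ω s = s' + t' • outerNormal Ω s') : s = s' ∧ t = t' := by
  have hn := isOuterUnitNormal_outerNormal hopen hC11 hs
  have hn' := isOuterUnitNormal_outerNormal hopen hC11 hs'
  have h1 := mul_nonpos_of_nonneg_of_nonpos ht.le (hn.inner_sub_nonpos hconv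
    (frontier_subset_closure hs) (frontier_subset_closure hs'))
  have h2 := mul_nonpos_of_nonneg_of_nonpos ht'.le (hn'.inner_sub_nonpos hconv
    (frontier_subset_closure hs') (frontier_subset_closure hs))
  rw [← real_inner_smul_left] at h1 h2
  have h3 : t • outerNormal Ω s = (s' - s) + t' • outerNormal Ω s' := by
    rw [sub_add_eq_add_sub, ← h]; abel
  rw [h3, inner_add_left, real_inner_self_eq_norm_sq] at h1
  rw [← neg_sub, inner_neg_right] at h2
  -- Pairing `t ν = (s' - s) + t' ν'` with `s' - s` gives a left side `≤ 0` and a right side `≥ ‖s'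
  -- - s‖²`, by the two supporting hyperplanes.
  have h4 : ‖s' - s‖ = 0 := by
    have : ‖s' - s‖ ^ 2 ≤ 0 := by linarith
    exact pow_eq_zero_iff two_ne_zero |>.1 (le_antisymm this (sq_nonneg _))
  have h5 : s = s' := (sub_eq_zero.1 (norm_eq_zero.1 h4)).symm
  refine ⟨h5, ?_⟩
  subst h5
  have h6 : t • outerNormal Ω s = t' • outerNormal Ω s := add_left_cancel h
  have h7 := congrArg (fun w => ⟪w, outerNormal Ω s⟫) h6
  simpa only [real_inner_smul_left, real_inner_self_eq_norm_sq, hn.1, one_pow, mul_one] using h7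

theorem disjoint_tube (hopen : IsOpen Ω) (hconv : Convex ℝ Ω) (hC11 : HasC11Boundary Ω)
    {B B' : Set (Euc n)} (hB : B ⊆ frontier Ω) (hB' : B' ⊆ frontier Ω) (h : Disjoint B B') :
    Disjoint (tube Ω B) (tube Ω B') := by
  rw [Set.disjoint_left]
  rintro x ⟨s, hs, t, ht, rfl⟩ ⟨s', hs', t', ht', hx⟩
  obtain ⟨rfl, -⟩ := eq_of_add_smul_outerNormal_eq hopen hconv hC11 (hB hs) (hB' hs') ht ht' hx
  exact Set.disjoint_left.1 h hs hs'

theorem tube_mono {B B' : Set (Euc n)} (h : B ⊆ B') : tube Ω B ⊆ tube Ω B' := by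
  rintro x ⟨s, hs, t, ht, rfl⟩
  exact ⟨s, h hs, t, ht, rfl⟩

end Tube

/-- A lower bound for the Dirichlet energy along a normal ray. -/
theorem sq_mul_inv_tubeIntegral_le_lintegral_ray {n k : ℕ} {κ : Fin k → ℝ} (hκ : ∀ i, 0 ≤ κ i)
    {φ : Euc n → ℝ} (hφ : ContDiff ℝ 1 φ) (hφ0 : HasCompactSupport φ) (s : Euc n) {ν : Euc n}
    (hν : ‖ν‖ = 1) :
    ENNReal.ofReal (φ s ^ 2) * (tubeIntegral κ)⁻¹ ≤
      ∫⁻ t in Ioi (0 : ℝ), ENNReal.ofReal (∏ i, (1 + t * κ i)) *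
        ENNReal.ofReal (‖gradient φ (s + t • ν)‖ ^ 2) := by
  set q : ℝ → ℝ := fun t => φ (s + t • ν) with hq
  have hq1 : ContDiff ℝ 1 q := hφ.comp (contDiff_const.add (contDiff_id.smul contDiff_const))
  have hiso : Isometry fun t : ℝ => s + t • ν := by
    refine Isometry.of_dist_eq fun t t' => ?_
    rw [dist_add_left, dist_eq_norm, ← sub_smul, norm_smul, hν, mul_one, dist_eq_norm]
  have hq0 : HasCompactSupport q := hφ0.comp_isClosedEmbedding hiso.isClosedEmbedding
  have h := sq_mul_inv_tubeIntegral_le hκ hq1 hq0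
  have hq00 : q 0 = φ s := by simp [hq]
  rw [hq00] at h
  refine h.trans (lintegral_mono fun t => ?_)
  refine mul_le_mul' le_rfl (ENNReal.ofReal_le_ofReal ?_)
  have h1 : HasDerivAt (fun t : ℝ => s + t • ν) ν t := by
    simpa using ((hasDerivAt_id t).smul_const ν).const_add s
  have h2 : HasDerivAt q (fderiv ℝ φ (s + t • ν) ν) t :=
    ((hφ.differentiable (by norm_num)) (s + t • ν)).hasFDerivAt.comp_hasDerivAt t h1
  rw [h2.deriv, ← toDual_gradient, InnerProductSpace.toDual_apply_apply, ← sq_abs]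
  refine pow_le_pow_left₀ (abs_nonneg _) ?_ 2
  simpa [hν] using abs_real_inner_le_norm (gradient φ (s + t • ν)) ν

/-- `Λ` is a lower bound for `(n - 2) L(κ₁, …, κ_{n-1})`. -/
def IsCurvatureBound {n : ℕ} (Ω : Set (Euc n)) (Λ : ℝ≥0∞) : Prop :=
  ∀ s κ, HasPrincipalCurvatures Ω s κ → Λ ≤ (tubeIntegral κ)⁻¹

namespace BoundaryPatch

variable {n : ℕ} {Ω : Set (Euc n)} {s₀ v : Euc n} (p : BoundaryPatch Ω s₀ v)

/-- A `K`-Lipschitz map enlarges `(n-1)`-dimensional Hausdorff measure by at most `K^(n-1)`. This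
one-sided bound, with `K` near `1`, does the work of an area formula. -/
theorem lintegral_le_of_lipschitzOnWith {K : ℝ≥0} {U : Set (Submodule.span ℝ {v})ᗮ}
    (hL : LipschitzOnWith K p.Ψ U) {B : Set (Euc n)} (hBm : MeasurableSet B)
    (hB : ∀ s ∈ B, s ∈ frontier Ω ∧ s ∈ p.V ∧ p.Q s ∈ U) (f : Euc n → ℝ≥0∞) (hf : Measurable f) :
    ∫⁻ s in B, f s ∂(surfaceMeasure Ω) ≤
      (K : ℝ≥0∞) ^ (n - 1) * ∫⁻ z in p.Ψ ⁻¹' B, f (p.Ψ z) := by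
  have hm : Measurable p.Ψ := p.contDiff_Ψ.continuous.measurable
  have h1 : (surfaceMeasure Ω).restrict B ≤
      (K : ℝ≥0∞) ^ (n - 1) • (volume.restrict (p.Ψ ⁻¹' B)).map p.Ψ := by
    refine Measure.le_iff.2 fun A hA => ?_
    rw [Measure.restrict_apply hA, Measure.smul_apply, Measure.map_apply hm hA,
      Measure.restrict_apply (hm hA), smul_eq_mul, surfaceMeasure,
      Measure.restrict_apply (hA.inter hBm)]
    have h2 : A ∩ B ∩ frontier Ω ⊆ p.Ψ '' (p.Ψ ⁻¹' A ∩ p.Ψ ⁻¹' B) := by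
      rintro s ⟨⟨hsA, hsB⟩, hsf⟩
      have h3 := (p.mem_frontier_iff s (hB s hsB).2.1).1 hsf
      refine ⟨p.Q s, ⟨?_, ?_⟩, h3⟩
      · rwa [mem_preimage, h3]
      · rwa [mem_preimage, h3]
    have h4 : LipschitzOnWith K p.Ψ (p.Ψ ⁻¹' A ∩ p.Ψ ⁻¹' B) := hL.mono fun z hz => by
      have := (hB _ hz.2).2.2
      rwa [p.Q_Ψ] at this
    refine (measure_mono h2).trans ((euclideanHausdorffMeasure_image_le h4 (n - 1)).trans_eq ?_)
    have h5 := InnerProductSpace.euclideanHausdorffMeasure_eq_volume (V := (Submodule.span ℝ {v})ᗮ)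
    rw [finrank_orthogonal_of_norm_eq_one p.norm_v] at h5
    rw [h5]
  refine (lintegral_mono' h1 le_rfl).trans_eq ?_
  rw [lintegral_smul_measure, lintegral_map hf hm, smul_eq_mul]

/-- The energy inequality over the part of the exterior domain above a small piece of the
boundary. -/
theorem exists_le_lintegral_tube (hopen : IsOpen Ω) (hconv : Convex ℝ Ω)
    (hC11 : HasC11Boundary Ω) {Λ : ℝ≥0∞} (hΛ : IsCurvatureBound Ω Λ) {φ : Euc n → ℝ}
    (hφ : ContDiff ℝ 1 φ) (hφ0 : HasCompactSupport φ) {δ : ℝ}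
    {B : Set (Euc n)} (hBm : MeasurableSet B)
    (hB : ∀ s ∈ B, s ∈ frontier Ω ∧ s ∈ p.V ∧ δ ≤ |(p.frame (p.Q s)).det|) :
    ∃ W ⊆ tube Ω B, MeasurableSet W ∧
      ENNReal.ofReal δ * (Λ * ∫⁻ z in p.Ψ ⁻¹' B, ENNReal.ofReal (φ (p.Ψ z) ^ 2)) ≤
        ∫⁻ x in W, ENNReal.ofReal (‖gradient φ x‖ ^ 2) := by
  have hm : Measurable p.Ψ := p.contDiff_Ψ.continuous.measurable
  set P := (Submodule.span ℝ {v})ᗮ.orthogonalProjectionOnto with hP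
  set Θ : Euc n → (Submodule.span ℝ {v})ᗮ × ℝ := fun x => (P x, ⟪v, x⟫) with hΘ
  have hΘm : MeasurePreserving Θ volume volume := measurePreserving_orthogonal_coordinates p.norm_v
  set D : Set (Submodule.span ℝ {v})ᗮ :=
    {z | DifferentiableAt ℝ p.N z} ∩ {z | DifferentiableAt ℝ (fderiv ℝ p.Ψ) z} with hD
  have hDm : MeasurableSet D :=
    (measurableSet_of_differentiableAt ℝ p.N).inter
      (measurableSet_of_differentiableAt ℝ (fderiv ℝ p.Ψ))
  set E := p.Ψ ⁻¹' B ∩ D with hE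
  have hEm : MeasurableSet E := (hm hBm).inter hDm
  have hEae : E =ᵐ[volume] p.Ψ ⁻¹' B := by
    filter_upwards [p.ae_differentiableAt] with z hz
    exact propext ⟨fun h => h.1, fun h => ⟨h, hz⟩⟩
  have hEB : ∀ z ∈ E, p.Ψ z ∈ frontier Ω ∧ p.Ψ z ∈ p.V ∧ δ ≤ |(p.frame z).det| := fun z hz => by
    have := hB _ hz.1
    rwa [p.Q_Ψ] at this
  -- Placing `E × (0, ∞)` inside `ℝⁿ` allows the change of variables formula for maps of `ℝⁿ` to
  -- itself.
  set X : Set (Euc n) := Θ ⁻¹' (E ×ˢ Ioi 0) with hX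
  have hXm : MeasurableSet X := hΘm.measurable (hEm.prod measurableSet_Ioi)
  set h : (Submodule.span ℝ {v})ᗮ × ℝ → ℝ≥0∞ := fun q =>
    ENNReal.ofReal |(p.frame q.1 + q.2 • (fderiv ℝ p.N q.1 ∘L P)).det| *
      ENNReal.ofReal (‖gradient φ (p.Ψ q.1 + q.2 • p.N q.1)‖ ^ 2) with hh
  have hgrad : Continuous (gradient φ) :=
    (InnerProductSpace.toDual ℝ (Euc n)).symm.continuous.comp
      (hφ.continuous_fderiv (by norm_num))
  have hφm : Measurable fun z => ENNReal.ofReal (φ (p.Ψ z) ^ 2) :=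
    ((hφ.continuous.comp p.contDiff_Ψ.continuous).pow 2).measurable.ennreal_ofReal
  have hhm : Measurable h := by
    have h1 : Measurable fun q : (Submodule.span ℝ {v})ᗮ × ℝ => fderiv ℝ p.N q.1 ∘L P := by
      have h2 : Continuous fun L : (Submodule.span ℝ {v})ᗮ →L[ℝ] Euc n => L ∘L P :=
        continuous_id.clm_comp continuous_const
      exact h2.measurable.comp ((measurable_fderiv ℝ p.N).comp measurable_fst)
    have h3 : Measurable fun q : (Submodule.span ℝ {v})ᗮ × ℝ =>
        p.frame q.1 + q.2 • (fderiv ℝ p.N q.1 ∘L P) :=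
      (p.continuous_frame.measurable.comp measurable_fst).add (measurable_snd.smul h1)
    have h4 : Measurable fun L : Euc n →L[ℝ] Euc n => L.det :=
      ContinuousLinearMap.continuous_det.measurable
    have h5 : Continuous fun q : (Submodule.span ℝ {v})ᗮ × ℝ =>
        ‖gradient φ (p.Ψ q.1 + q.2 • p.N q.1)‖ ^ 2 :=
      (hgrad.comp ((p.contDiff_Ψ.continuous.comp continuous_fst).add
        (continuous_snd.smul (p.continuous_N.comp continuous_fst)))).norm.pow 2
    exact ((h4.comp h3).abs.ennreal_ofReal).mul h5.measurable.ennreal_ofReal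
  -- Normal rays do not meet, so the foot point and the height are determined; `Q` recovers the
  -- parameter from the foot point.
  have hinj : InjOn p.tubeMap X := by
    intro x hx y hy hxy
    have hx1 := hEB _ hx.1
    have hy1 := hEB _ hy.1
    have hx2 : p.tubeMap x = p.Ψ (P x) + ⟪v, x⟫ • outerNormal Ω (p.Ψ (P x)) := by
      rw [p.outerNormal_eq hx1.2.1]; rfl
    have hy2 : p.tubeMap y = p.Ψ (P y) + ⟪v, y⟫ • outerNormal Ω (p.Ψ (P y)) := by
      rw [p.outerNormal_eq hy1.2.1]; rfl
    rw [hx2, hy2] at hxy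
    obtain ⟨h1, h2⟩ : p.Ψ (P x) = p.Ψ (P y) ∧ ⟪v, x⟫ = ⟪v, y⟫ :=
      eq_of_add_smul_outerNormal_eq hopen hconv hC11 hx1.1 hy1.1 hx.2 hy.2 hxy
    have h3 : P x = P y := by rw [← p.Q_Ψ (P x), h1, p.Q_Ψ]
    have h4 := congrArg (Subtype.val) h3
    rw [hP, coe_orthogonalProjectionOnto_span_singleton p.norm_v,
      coe_orthogonalProjectionOnto_span_singleton p.norm_v, h2] at h4
    exact sub_left_injective h4
  have hderiv : ∀ x ∈ X, HasFDerivWithinAt p.tubeMap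
      (p.frame (P x) + ⟪v, x⟫ • (fderiv ℝ p.N (P x) ∘L P)) X x := fun x hx =>
    (p.hasFDerivAt_tubeMap hx.1.2.1).hasFDerivWithinAt
  refine ⟨p.tubeMap '' X, ?_, measurable_image_of_fderivWithin hXm hderiv hinj, ?_⟩
  · rintro _ ⟨x, hx, rfl⟩
    refine ⟨p.Ψ (P x), hx.1.1, ⟪v, x⟫, hx.2, ?_⟩
    rw [p.outerNormal_eq (hEB _ hx.1).2.1]
    rfl
  rw [lintegral_image_eq_lintegral_abs_det_fderiv_mul volume hXm hderiv hinj]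
  have h1 : ∫⁻ x in X, ENNReal.ofReal |(p.frame (P x) + ⟪v, x⟫ • (fderiv ℝ p.N (P x) ∘L P)).det| *
      ENNReal.ofReal (‖gradient φ (p.tubeMap x)‖ ^ 2) = ∫⁻ q in E ×ˢ Ioi 0, h q :=
    hΘm.setLIntegral_comp_preimage (hEm.prod measurableSet_Ioi) hhm
  rw [h1, Measure.volume_eq_prod, ← Measure.prod_restrict, lintegral_prod _ hhm.aemeasurable,
    ← setLIntegral_congr hEae, ← lintegral_const_mul _ hφm,
    ← lintegral_const_mul _ (hφm.const_mul _)]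
  refine setLIntegral_mono' hEm fun z hz => ?_
  obtain ⟨hz1, hz2, hz3⟩ := hEB z hz
  obtain ⟨κ, e, he, hNe, hκe⟩ := p.exists_eigenbasis hz.2.1 hz.2.2
  have hPC : HasPrincipalCurvatures Ω (p.Ψ z) κ := by
    refine ⟨hz1, fderiv ℝ p.N z ∘L p.Q, e, p.hasFDerivWithinAt_outerNormal hz2 hz.2.1, he, ?_, hκe⟩
    rw [p.outerNormal_eq hz2]
    exact hNe
  have hκ : ∀ j, 0 ≤ κ j := hPC.nonneg hopen hconv hC11
  have h2 := sq_mul_inv_tubeIntegral_le_lintegral_ray hκ hφ hφ0 (p.Ψ z) (p.norm_N z)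
  calc ENNReal.ofReal δ * (Λ * ENNReal.ofReal (φ (p.Ψ z) ^ 2)) ≤
      ENNReal.ofReal |(p.frame z).det| *
        (ENNReal.ofReal (φ (p.Ψ z) ^ 2) * (tubeIntegral κ)⁻¹) := by
        rw [mul_comm Λ]
        gcongr
        exact hΛ _ _ hPC
    _ ≤ ENNReal.ofReal |(p.frame z).det| *
        ∫⁻ t in Ioi (0 : ℝ), ENNReal.ofReal (∏ i, (1 + t * κ i)) *
          ENNReal.ofReal (‖gradient φ (p.Ψ z + t • p.N z)‖ ^ 2) := by gcongr
    _ = _ := by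
      rw [← lintegral_const_mul' _ _ ENNReal.ofReal_ne_top]
      refine setLIntegral_congr_fun measurableSet_Ioi fun t ht => ?_
      simp only [hh]
      rw [p.det_tubeMap he hNe hκe, abs_mul, abs_of_pos (prod_one_add_mul_pos hκ ht),
        ENNReal.ofReal_mul (prod_one_add_mul_pos hκ ht).le]
      ring

end BoundaryPatch

/-- The energy inequality for test functions. -/
theorem mul_lintegral_sq_le_energy {n : ℕ} {Ω : Set (Euc n)} (hopen : IsOpen Ω)
    (hbdd : Bornology.IsBounded Ω) (hconv : Convex ℝ Ω) (hC11 : HasC11Boundary Ω)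
    {Λ : ℝ≥0∞} (hΛ : IsCurvatureBound Ω Λ) {φ : Euc n → ℝ} (hφ : ContDiff ℝ 1 φ)
    (hφ0 : HasCompactSupport φ) :
    Λ * ∫⁻ s, ENNReal.ofReal (φ s ^ 2) ∂(surfaceMeasure Ω) ≤
      ∫⁻ x in ext Ω, ENNReal.ofReal (‖gradient φ x‖ ^ 2) := by
  have hφm : Measurable fun s => ENNReal.ofReal (φ s ^ 2) :=
    (hφ.continuous.pow 2).measurable.ennreal_ofReal
  set F : Euc n → ℝ≥0∞ := fun s => ENNReal.ofReal (φ s ^ 2) with hF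
  -- The factor `c` absorbs the distortion of the patches; it tends to `1` at the end.
  have key : ∀ c : ℝ, 0 < c → c < 1 →
      ENNReal.ofReal c * (Λ * ∫⁻ s, F s ∂(surfaceMeasure Ω)) ≤
        ∫⁻ x in ext Ω, ENNReal.ofReal (‖gradient φ x‖ ^ 2) := by
    intro c hc0 hc1
    have hcpt : IsCompact (frontier Ω) :=
      Metric.isCompact_of_isClosed_isBounded isClosed_frontier
        (hbdd.closure.subset frontier_subset_closure)
    -- Compactness induction. The claim is made for all measurable pieces `B` of `A`, with an energy
    -- region `W` inside the tube over `B`, so that disjoint pieces have disjoint regions and their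
    -- energies add up.
    have hind : ∃ A, frontier Ω ⊆ A ∧ MeasurableSet A ∧ ∀ B, MeasurableSet B → B ⊆ A →
        B ⊆ frontier Ω → ∃ W ⊆ tube Ω B, MeasurableSet W ∧
          ENNReal.ofReal c * (Λ * ∫⁻ s in B, F s ∂(surfaceMeasure Ω)) ≤
            ∫⁻ x in W, ENNReal.ofReal (‖gradient φ x‖ ^ 2) := by
      refine hcpt.induction_on (p := fun S => ∃ A, S ⊆ A ∧ MeasurableSet A ∧ ∀ B, MeasurableSet B →
        B ⊆ A → B ⊆ frontier Ω → ∃ W ⊆ tube Ω B, MeasurableSet W ∧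
          ENNReal.ofReal c * (Λ * ∫⁻ s in B, F s ∂(surfaceMeasure Ω)) ≤
            ∫⁻ x in W, ENNReal.ofReal (‖gradient φ x‖ ^ 2)) ?_ ?_ ?_ ?_
      · refine ⟨∅, le_rfl, MeasurableSet.empty, fun B _ hB _ => ⟨∅, empty_subset _,
          MeasurableSet.empty, ?_⟩⟩
        rw [subset_empty_iff.1 hB]
        simp
      · rintro S T hST ⟨A, hA, h⟩
        exact ⟨A, hST.trans hA, h⟩
      · rintro S T ⟨A, hSA, hAm, hA⟩ ⟨A', hTA, hAm', hA'⟩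
        refine ⟨A ∪ A', union_subset_union hSA hTA, hAm.union hAm', fun B hBm hBA hBf => ?_⟩
        obtain ⟨W, hW, hWm, hWi⟩ := hA (B ∩ A) (hBm.inter hAm) inter_subset_right
          (inter_subset_left.trans hBf)
        obtain ⟨W', hW', hWm', hWi'⟩ := hA' (B \ A) (hBm.diff hAm)
          (fun s hs => (hBA hs.1).resolve_left hs.2) (sdiff_subset.trans hBf)
        have hdisj : Disjoint W W' := (disjoint_tube hopen hconv hC11 (inter_subset_left.trans hBf)
          (sdiff_subset.trans hBf) disjoint_inf_sdiff).mono hW hW'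
        refine ⟨W ∪ W', union_subset (hW.trans (tube_mono inter_subset_left))
          (hW'.trans (tube_mono sdiff_subset)), hWm.union hWm', ?_⟩
        rw [lintegral_union hWm' hdisj, ← lintegral_inter_add_sdiff F B hAm, mul_add, mul_add]
        exact add_le_add hWi hWi'
      · intro s₀ hs₀
        obtain ⟨v, ⟨p⟩⟩ := exists_boundaryPatch hopen hC11 hs₀
        obtain ⟨δ, hδc, hδ1⟩ := exists_between hc1
        -- Here `δ` bounds the frame determinant from below and `K` is the Lipschitz constant of
        -- `Ψ`; the choice `c K^(n-1) ≤ δ` lets the two losses fit into `c`.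
        obtain ⟨K, hK1, hK⟩ : ∃ K : ℝ≥0, 1 < K ∧ c * (K : ℝ) ^ (n - 1) ≤ δ := by
          have h1 : Tendsto (fun K : ℝ≥0 => c * (K : ℝ) ^ (n - 1)) (𝓝[>] 1) (𝓝 c) := by
            have : Continuous fun K : ℝ≥0 => c * (K : ℝ) ^ (n - 1) := by fun_prop
            simpa using (this.tendsto 1).mono_left (nhdsWithin_le_nhds (s := Ioi 1))
          obtain ⟨K, hK1, hK2⟩ :=
            ((h1.eventually (gt_mem_nhds hδc)).and self_mem_nhdsWithin).exists
          exact ⟨K, hK2, hK1.le⟩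
        have hstrict : HasStrictFDerivAt p.Ψ ((Submodule.span ℝ {v})ᗮ.subtypeL) (p.Q s₀) := by
          rw [← p.fderiv_Ψ]
          exact p.contDiff_Ψ.contDiffAt.hasStrictFDerivAt (by norm_num)
        obtain ⟨U, hU, hUL⟩ := hstrict.exists_lipschitzOnWith_of_nnnorm_lt K
          (lt_of_le_of_lt (Submodule.norm_subtypeL_le _) hK1)
        have hdet : ∀ᶠ z in 𝓝 (p.Q s₀), δ ≤ |(p.frame z).det| := by
          have h1 : Continuous fun z => |(p.frame z).det| :=
            (ContinuousLinearMap.continuous_det.comp p.continuous_frame).abs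
          have h2 : |(p.frame (p.Q s₀)).det| = 1 := by
            rw [p.frame_Q]
            simp [ContinuousLinearMap.det]
          filter_upwards [h1.continuousAt.eventually (lt_mem_nhds (h2 ▸ hδ1))] with z hz using hz.le
        obtain ⟨A, hA, hAo, hsA⟩ := mem_nhds_iff.1
          (inter_mem (p.isOpen_V.mem_nhds p.mem_V)
            (p.Q.continuous.continuousAt.eventually ((eventually_mem_set.2 hU).and hdet)))
        refine ⟨A, mem_nhdsWithin_of_mem_nhds (hAo.mem_nhds hsA), A, le_rfl, hAo.measurableSet,
          fun B hBm hBA hBf => ?_⟩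
        obtain ⟨W, hW, hWm, hWi⟩ := p.exists_le_lintegral_tube hopen hconv hC11 hΛ hφ hφ0 hBm
          (fun s hs => ⟨hBf hs, (hA (hBA hs)).1, (hA (hBA hs)).2.2⟩)
        refine ⟨W, hW, hWm, le_trans ?_ hWi⟩
        have h1 := p.lintegral_le_of_lipschitzOnWith hUL hBm
          (fun s hs => ⟨hBf hs, (hA (hBA hs)).1, (hA (hBA hs)).2.1⟩) F hφm
        calc _ ≤ ENNReal.ofReal c * (Λ * ((K : ℝ≥0∞) ^ (n - 1) *
              ∫⁻ z in p.Ψ ⁻¹' B, F (p.Ψ z))) := by gcongr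
          _ = (ENNReal.ofReal c * (K : ℝ≥0∞) ^ (n - 1)) *
              (Λ * ∫⁻ z in p.Ψ ⁻¹' B, F (p.Ψ z)) := by ring
          _ ≤ _ := by
            gcongr
            rw [← ENNReal.ofReal_coe_nnreal, ← ENNReal.ofReal_pow (by positivity),
              ← ENNReal.ofReal_mul hc0.le]
            exact ENNReal.ofReal_le_ofReal hK
    obtain ⟨A, hA, -, h⟩ := hind
    obtain ⟨W, hW, -, hWi⟩ := h (frontier Ω) isClosed_frontier.measurableSet hA le_rfl
    have h1 : (surfaceMeasure Ω).restrict (frontier Ω) = surfaceMeasure Ω := by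
      rw [surfaceMeasure, Measure.restrict_restrict isClosed_frontier.measurableSet, inter_self]
    rw [h1] at hWi
    exact hWi.trans (lintegral_mono_set (hW.trans (tube_subset_ext hopen hconv hC11)))
  have hlim : Tendsto (fun c : ℝ => ENNReal.ofReal c * (Λ * ∫⁻ s, F s ∂(surfaceMeasure Ω)))
      (𝓝[<] 1) (𝓝 (ENNReal.ofReal 1 * (Λ * ∫⁻ s, F s ∂(surfaceMeasure Ω)))) := by
    refine ENNReal.Tendsto.mul_const ?_ (Or.inl (by simp))
    exact (ENNReal.continuous_ofReal.tendsto 1).mono_left nhdsWithin_le_nhds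
  rw [ENNReal.ofReal_one, one_mul] at hlim
  refine le_of_tendsto hlim ?_
  filter_upwards [self_mem_nhdsWithin, nhdsWithin_le_nhds (lt_mem_nhds one_pos)] with c hc1 hc0
  exact key c hc0 hc1

end ExteriorSteklov

namespace ExteriorSteklov

/-! ### Convergence in `L²` -/

section L2

variable {X E : Type*} [MeasurableSpace X] {μ : Measure X} [NormedAddCommGroup E]

theorem eLpNorm_two_sq (f : X → E) (μ : Measure X) :
    eLpNorm f 2 μ ^ 2 = ∫⁻ x, ENNReal.ofReal (‖f x‖ ^ 2) ∂μ := by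
  rw [eLpNorm_eq_lintegral_rpow_enorm_toReal two_ne_zero ENNReal.ofNat_ne_top,
    ← ENNReal.rpow_natCast, ← ENNReal.rpow_mul]
  simp only [ENNReal.toReal_ofNat, ENNReal.rpow_two, Nat.cast_ofNat]
  rw [one_div, inv_mul_cancel₀ two_ne_zero, ENNReal.rpow_one]
  refine lintegral_congr fun x => ?_
  rw [ENNReal.ofReal_pow (norm_nonneg _), ofReal_norm]

theorem eLpNorm_two_sq_eq_ofReal {f : X → E} (hf : MemLp f 2 μ) :
    eLpNorm f 2 μ ^ 2 = ENNReal.ofReal (∫ x, ‖f x‖ ^ 2 ∂μ) := by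
  rw [eLpNorm_two_sq, ofReal_integral_eq_lintegral_ofReal hf.norm.integrable_sq
    (ae_of_all _ fun x => sq_nonneg _)]

variable {a : ℕ → X → E} {b : X → E}

theorem tendsto_eLpNorm_of_tendsto_sub (ha : ∀ k, MemLp (a k) 2 μ) (hb : MemLp b 2 μ)
    (h : Tendsto (fun k => eLpNorm (fun x => a k x - b x) 2 μ) atTop (𝓝 0)) :
    Tendsto (fun k => eLpNorm (a k) 2 μ) atTop (𝓝 (eLpNorm b 2 μ)) := by
  have h1 := ((Lp.tendsto_Lp_iff_tendsto_eLpNorm'' a ha b hb).2 h).norm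
  simp only [Lp.norm_toLp] at h1
  exact (ENNReal.tendsto_toReal_iff (fun k => (ha k).eLpNorm_ne_top) hb.eLpNorm_ne_top).1 h1

theorem tendsto_integral_inner [InnerProductSpace ℝ E] {c : X → E} (hc : MemLp c 2 μ)
    (ha : ∀ k, MemLp (a k) 2 μ) (hb : MemLp b 2 μ)
    (h : Tendsto (fun k => eLpNorm (fun x => a k x - b x) 2 μ) atTop (𝓝 0)) :
    Tendsto (fun k => ∫ x, ⟪c x, a k x⟫ ∂μ) atTop (𝓝 (∫ x, ⟪c x, b x⟫ ∂μ)) := by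
  have h1 := (Lp.tendsto_Lp_iff_tendsto_eLpNorm'' a ha b hb).2 h
  have h2 := (tendsto_const_nhds (x := hc.toLp c)).inner (𝕜 := ℝ) h1
  have h3 : ∀ (g : X → E) (hg : MemLp g 2 μ),
      ⟪hc.toLp c, hg.toLp g⟫ = ∫ x, ⟪c x, g x⟫ ∂μ := fun g hg => by
    rw [L2.inner_def]
    refine integral_congr_ae ?_
    filter_upwards [hc.coeFn_toLp, hg.coeFn_toLp] with x hx1 hx2
    rw [hx1, hx2]
  simpa only [h3] using h2

/-- Multiplication by bounded functions is continuous in `L²`. -/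
theorem tendsto_eLpNorm_smul_add_smul [NormedSpace ℝ E] {φ : ℕ → X → ℝ} {u : X → ℝ}
    {c : X → ℝ} {d : X → E} {M : ℝ} (hc : AEStronglyMeasurable c μ) (hd : AEStronglyMeasurable d μ)
    (hcM : ∀ x, |c x| ≤ M) (hdM : ∀ x, ‖d x‖ ≤ M)
    (ha : ∀ k, MemLp (a k) 2 μ) (hb : MemLp b 2 μ) (hφ : ∀ k, MemLp (φ k) 2 μ) (hu : MemLp u 2 μ)
    (h : Tendsto (fun k => eLpNorm (fun x => a k x - b x) 2 μ) atTop (𝓝 0))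
    (h' : Tendsto (fun k => eLpNorm (fun x => φ k x - u x) 2 μ) atTop (𝓝 0)) :
    Tendsto (fun k => eLpNorm (fun x => (c x • a k x + φ k x • d x) - (c x • b x + u x • d x)) 2 μ)
      atTop (𝓝 0) := by
  have h1 : Tendsto (fun k => ENNReal.ofReal M * eLpNorm (fun x => a k x - b x) 2 μ +
      ENNReal.ofReal M * eLpNorm (fun x => φ k x - u x) 2 μ) atTop (𝓝 0) := by
    have h2 := (ENNReal.Tendsto.const_mul (a := ENNReal.ofReal M) h (Or.inr ENNReal.ofReal_ne_top)).add
      (ENNReal.Tendsto.const_mul (a := ENNReal.ofReal M) h' (Or.inr ENNReal.ofReal_ne_top))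
    simpa using h2
  refine tendsto_of_tendsto_of_tendsto_of_le_of_le tendsto_const_nhds h1 (fun k => zero_le)
    fun k => ?_
  have h3 : (fun x => (c x • a k x + φ k x • d x) - (c x • b x + u x • d x)) =
      (fun x => c x • (a k x - b x)) + fun x => (φ k x - u x) • d x := by
    ext x
    simp only [Pi.add_apply, smul_sub, sub_smul]
    abel
  rw [h3]
  have h4 : AEStronglyMeasurable (fun x => a k x - b x) μ := (ha k).1.sub hb.1
  have h5 : AEStronglyMeasurable (fun x => φ k x - u x) μ := (hφ k).1.sub hu.1
  refine (eLpNorm_add_le (hc.smul h4) (h5.smul hd) one_le_two).trans (add_le_add ?_ ?_)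
  · refine eLpNorm_le_mul_eLpNorm_of_ae_le_mul (ae_of_all _ fun x => ?_) 2
    rw [Pi.smul_apply', norm_smul]
    exact mul_le_mul_of_nonneg_right (hcM x) (norm_nonneg _)
  · refine eLpNorm_le_mul_eLpNorm_of_ae_le_mul (ae_of_all _ fun x => ?_) 2
    rw [Pi.smul_apply', norm_smul, mul_comm]
    exact mul_le_mul_of_nonneg_right (hdM x) (norm_nonneg _)

theorem memLp_smul_of_bound [NormedSpace ℝ E] {c : X → ℝ} {M : ℝ} (hc : AEStronglyMeasurable c μ)
    (hcM : ∀ x, |c x| ≤ M) (hb : MemLp b 2 μ) : MemLp (fun x => c x • b x) 2 μ :=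
  hb.of_le_mul (c := M) (hc.smul hb.1) (ae_of_all _ fun x => by
    rw [norm_smul]
    exact mul_le_mul_of_nonneg_right (hcM x) (norm_nonneg _))

theorem memLp_smul_of_bound' [NormedSpace ℝ E] {u : X → ℝ} {d : X → E} {M : ℝ}
    (hd : AEStronglyMeasurable d μ) (hdM : ∀ x, ‖d x‖ ≤ M) (hu : MemLp u 2 μ) :
    MemLp (fun x => u x • d x) 2 μ :=
  hu.of_le_mul (c := M) (hu.1.smul hd) (ae_of_all _ fun x => by
    rw [norm_smul, mul_comm]
    exact mul_le_mul_of_nonneg_right (hdM x) (norm_nonneg _))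

end L2

/-! ### A Hardy inequality in the exterior of a convex body -/

/-- Otherwise contracting the dilated point towards `o` would put `x` in the closure by convexity.
-/
theorem add_smul_sub_mem_ext {n : ℕ} {Ω : Set (Euc n)} (hconv : Convex ℝ Ω) {o x : Euc n}
    (ho : o ∈ Ω) (hx : x ∈ ext Ω) {t : ℝ} (ht : 1 < t) : o + t • (x - o) ∈ ext Ω := by
  intro h
  have h1 := hconv.closure.add_smul_sub_mem (subset_closure ho) h
    (t := t⁻¹) ⟨by positivity, inv_le_one_of_one_le₀ ht.le⟩
  rw [add_sub_cancel_left, smul_smul, inv_mul_cancel₀ (by positivity), one_smul,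
    add_sub_cancel] at h1
  exact hx h1

theorem lintegral_comp_homothety {n : ℕ} (o : Euc n) {t : ℝ} (ht : 0 < t) (h : Euc n → ℝ≥0∞)
    (hm : Measurable h) :
    ∫⁻ x, h (o + t • (x - o)) = ENNReal.ofReal (t ^ n)⁻¹ * ∫⁻ x, h x := by
  rw [lintegral_sub_right_eq_self (fun x => h (o + t • x)) o]
  have h1 := Measure.map_addHaar_smul (volume : Measure (Euc n)) ht.ne'
  rw [finrank_euclideanSpace_fin, abs_of_pos (by positivity)] at h1
  have h2 : ∫⁻ x, h (o + t • x) = ∫⁻ y, h (o + y) ∂(Measure.map (t • ·) (volume : Measure (Euc n))) :=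
    (lintegral_map (hm.comp (measurable_const_add o)) (measurable_const_smul t)).symm
  rw [h2, h1, lintegral_smul_measure, lintegral_add_left_eq_self, smul_eq_mul]

/-- Cauchy–Schwarz on the ray from `o` through `x`, with weights `t^(±3/2)`. The power `-3/2` is
integrable at infinity, and it remains so after `t^(3/2)` meets the dilation factor `t^(-n)`,
because `n ≥ 3`. -/
theorem sq_le_lintegral_ray {n : ℕ} {o x : Euc n} (hxo : x ≠ o) {φ : Euc n → ℝ}
    (hφ : ContDiff ℝ 1 φ) (hφ0 : HasCompactSupport φ) :
    ENNReal.ofReal (φ x ^ 2) ≤ ENNReal.ofReal (‖x - o‖ ^ 2) *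
      ((∫⁻ t in Ioi (1 : ℝ), ENNReal.ofReal (t ^ (-(3 / 2) : ℝ))) *
        ∫⁻ t in Ioi (1 : ℝ), ENNReal.ofReal (t ^ (3 / 2 : ℝ)) *
          ENNReal.ofReal (‖gradient φ (o + t • (x - o))‖ ^ 2)) := by
  set q : ℝ → ℝ := fun t => φ (o + t • (x - o)) with hq
  have hq1 : ContDiff ℝ 1 q := hφ.comp (contDiff_const.add (contDiff_id.smul contDiff_const))
  have hq0 : HasCompactSupport q := by
    have : IsClosedEmbedding fun t : ℝ => o + t • (x - o) :=
      (Homeomorph.addLeft o).isClosedEmbedding.comp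
        (isClosedEmbedding_smul_left (sub_ne_zero.2 hxo))
    exact hφ0.comp_isClosedEmbedding this
  have hgrad : Continuous (gradient φ) :=
    (InnerProductSpace.toDual ℝ (Euc n)).symm.continuous.comp
      (hφ.continuous_fderiv (by norm_num))
  have h1 : ENNReal.ofReal |φ x| ≤ ∫⁻ t in Ioi (1 : ℝ), ENNReal.ofReal |deriv q t| := by
    have h2 : ∫ t in Ioi (1 : ℝ), deriv q t = - φ x := by
      rw [hq0.integral_Ioi_deriv_eq hq1 1]
      simp [hq]
    rw [← abs_neg, ← h2, ← Real.norm_eq_abs, ofReal_norm]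
    refine (enorm_integral_le_lintegral_enorm _).trans (le_of_eq ?_)
    simp only [← Real.norm_eq_abs, ofReal_norm]
  have h3 : ∀ t, |deriv q t| ≤ ‖x - o‖ * ‖gradient φ (o + t • (x - o))‖ := fun t => by
    have h1 : HasDerivAt (fun t : ℝ => o + t • (x - o)) (x - o) t := by
      simpa using ((hasDerivAt_id t).smul_const (x - o)).const_add o
    have h2 : HasDerivAt q (fderiv ℝ φ (o + t • (x - o)) (x - o)) t :=
      ((hφ.differentiable (by norm_num)) (o + t • (x - o))).hasFDerivAt.comp_hasDerivAt t h1
    rw [h2.deriv, ← toDual_gradient, InnerProductSpace.toDual_apply_apply, mul_comm]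
    exact abs_real_inner_le_norm _ _
  have h4 : ∀ t ∈ Ioi (1 : ℝ), ENNReal.ofReal |deriv q t| ≤ ENNReal.ofReal ‖x - o‖ *
      (ENNReal.ofReal (t ^ (-(3 / 4) : ℝ)) *
        ENNReal.ofReal (t ^ (3 / 4 : ℝ) * ‖gradient φ (o + t • (x - o))‖)) := fun t ht => by
    have ht0 : (0 : ℝ) < t := one_pos.trans ht
    rw [← ENNReal.ofReal_mul (by positivity), ← ENNReal.ofReal_mul (by positivity)]
    refine ENNReal.ofReal_le_ofReal ((h3 t).trans_eq ?_)
    rw [← mul_assoc (t ^ _), ← Real.rpow_add ht0]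
    norm_num
  have h5 : ENNReal.ofReal |φ x| ≤ ENNReal.ofReal ‖x - o‖ * ∫⁻ t in Ioi (1 : ℝ),
      ENNReal.ofReal (t ^ (-(3 / 4) : ℝ)) *
        ENNReal.ofReal (t ^ (3 / 4 : ℝ) * ‖gradient φ (o + t • (x - o))‖) := by
    rw [← lintegral_const_mul' _ _ ENNReal.ofReal_ne_top]
    exact h1.trans (setLIntegral_mono' measurableSet_Ioi h4)
  have hgm : Measurable fun t : ℝ => ‖gradient φ (o + t • (x - o))‖ := by fun_prop
  calc ENNReal.ofReal (φ x ^ 2) = ENNReal.ofReal |φ x| ^ 2 := by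
        rw [← ENNReal.ofReal_pow (abs_nonneg _), sq_abs]
    _ ≤ _ := pow_le_pow_left₀ zero_le h5 2
    _ ≤ _ := by
      rw [mul_pow, ← ENNReal.ofReal_pow (norm_nonneg _)]
      refine mul_le_mul' le_rfl ((sq_lintegral_mul_le _ (by fun_prop) (by fun_prop)).trans_eq ?_)
      congr 1
      · refine setLIntegral_congr_fun measurableSet_Ioi fun t ht => ?_
        have ht0 : (0 : ℝ) < t := one_pos.trans ht
        rw [← ENNReal.ofReal_pow (by positivity), ← Real.rpow_natCast, ← Real.rpow_mul ht0.le]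
        norm_num
      · refine setLIntegral_congr_fun measurableSet_Ioi fun t ht => ?_
        have ht0 : (0 : ℝ) < t := one_pos.trans ht
        rw [← ENNReal.ofReal_pow (by positivity), ← ENNReal.ofReal_mul (by positivity), mul_pow,
          ← Real.rpow_natCast, ← Real.rpow_mul ht0.le]
        norm_num

/-- Integrating the ray estimate in `x` and swapping the integrals leaves, for each `t`, a dilation
about `o` that maps the exterior into itself. No boundary term appears, so zero energy forces zero,
also when the trace vanishes. -/
theorem exists_lintegral_sq_le_energy {n : ℕ} (hn : 3 ≤ n) {Ω : Set (Euc n)} (hconv : Convex ℝ Ω)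
    {o : Euc n} (ho : o ∈ Ω) (ρ : ℝ) : ∃ K : ℝ≥0∞, K ≠ ⊤ ∧ ∀ φ : Euc n → ℝ, ContDiff ℝ 1 φ →
      HasCompactSupport φ → ∫⁻ x, ENNReal.ofReal (φ x ^ 2) ∂(truncVolume Ω ρ) ≤
        K * ∫⁻ x in ext Ω, ENNReal.ofReal (‖gradient φ x‖ ^ 2) := by
  set A := ∫⁻ t in Ioi (1 : ℝ), ENNReal.ofReal (t ^ (-(3 / 2) : ℝ)) with hA
  have hA' : A ≠ ⊤ := by
    have h1 : IntegrableOn (fun t : ℝ => t ^ (-(3 / 2) : ℝ)) (Ioi 1) :=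
      integrableOn_Ioi_rpow_of_lt (by norm_num) one_pos
    exact h1.lintegral_lt_top.ne
  refine ⟨ENNReal.ofReal ((ρ + ‖o‖) ^ 2) * (A * A), ?_, fun φ hφ hφ0 => ?_⟩
  · exact ENNReal.mul_ne_top ENNReal.ofReal_ne_top (ENNReal.mul_ne_top hA' hA')
  have hext : MeasurableSet (ext Ω) := isClosed_closure.measurableSet.compl
  have hgrad : Continuous (gradient φ) :=
    (InnerProductSpace.toDual ℝ (Euc n)).symm.continuous.comp
      (hφ.continuous_fderiv (by norm_num))
  -- Extending by zero turns the dilated integrals into integrals over the whole space.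
  set g : Euc n → ℝ≥0∞ := (ext Ω).indicator fun x => ENNReal.ofReal (‖gradient φ x‖ ^ 2) with hg
  have hgm : Measurable g := (hgrad.norm.pow 2).measurable.ennreal_ofReal.indicator hext
  have h1 : ∀ x ∈ ext Ω ∩ Metric.ball 0 ρ, ENNReal.ofReal (φ x ^ 2) ≤
      ENNReal.ofReal ((ρ + ‖o‖) ^ 2) * (A * ∫⁻ t in Ioi (1 : ℝ),
        ENNReal.ofReal (t ^ (3 / 2 : ℝ)) * g (o + t • (x - o))) := fun x hx => by
    have hxo : x ≠ o := by
      rintro rfl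
      exact hx.1 (subset_closure ho)
    refine (sq_le_lintegral_ray hxo hφ hφ0).trans (mul_le_mul' ?_ (mul_le_mul' le_rfl ?_))
    · refine ENNReal.ofReal_le_ofReal (pow_le_pow_left₀ (norm_nonneg _) ?_ 2)
      have := mem_ball_zero_iff.1 hx.2
      exact (norm_sub_le x o).trans (by linarith)
    · refine setLIntegral_mono' measurableSet_Ioi fun t ht => ?_
      rw [hg, indicator_of_mem (add_smul_sub_mem_ext hconv ho hx.1 ht)]
  have hjm : Measurable fun q : Euc n × ℝ =>
      ENNReal.ofReal (q.2 ^ (3 / 2 : ℝ)) * g (o + q.2 • (q.1 - o)) := by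
    refine Measurable.mul (by fun_prop) (hgm.comp (by fun_prop))
  calc ∫⁻ x, ENNReal.ofReal (φ x ^ 2) ∂(truncVolume Ω ρ)
      ≤ ∫⁻ x in ext Ω ∩ Metric.ball 0 ρ, ENNReal.ofReal ((ρ + ‖o‖) ^ 2) * (A *
        ∫⁻ t in Ioi (1 : ℝ), ENNReal.ofReal (t ^ (3 / 2 : ℝ)) * g (o + t • (x - o))) :=
        setLIntegral_mono' (hext.inter Metric.isOpen_ball.measurableSet) h1
    _ ≤ ∫⁻ x, ENNReal.ofReal ((ρ + ‖o‖) ^ 2) * (A *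
        ∫⁻ t in Ioi (1 : ℝ), ENNReal.ofReal (t ^ (3 / 2 : ℝ)) * g (o + t • (x - o))) :=
        setLIntegral_le_lintegral _ _
    _ = ENNReal.ofReal ((ρ + ‖o‖) ^ 2) * (A * ∫⁻ t in Ioi (1 : ℝ), ∫⁻ x,
        ENNReal.ofReal (t ^ (3 / 2 : ℝ)) * g (o + t • (x - o))) := by
        rw [lintegral_const_mul' _ _ ENNReal.ofReal_ne_top, lintegral_const_mul' _ _ hA',
          lintegral_lintegral_swap hjm.aemeasurable]
    _ ≤ ENNReal.ofReal ((ρ + ‖o‖) ^ 2) * (A * ∫⁻ t in Ioi (1 : ℝ),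
        ENNReal.ofReal (t ^ (-(3 / 2) : ℝ)) * ∫⁻ x, g x) := by
        refine mul_le_mul' le_rfl (mul_le_mul' le_rfl ?_)
        refine setLIntegral_mono' measurableSet_Ioi fun t ht => ?_
        have ht1 : (1 : ℝ) < t := ht
        have ht0 : (0 : ℝ) < t := one_pos.trans ht
        rw [lintegral_const_mul' _ _ ENNReal.ofReal_ne_top, lintegral_comp_homothety o ht0 g hgm,
          ← mul_assoc, ← ENNReal.ofReal_mul (by positivity)]
        gcongr
        rw [← Real.rpow_natCast, ← Real.rpow_neg ht0.le, ← Real.rpow_add ht0]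
        refine Real.rpow_le_rpow_of_exponent_le ht1.le ?_
        have : (3 : ℝ) ≤ n := by exact_mod_cast hn
        linarith
    _ = _ := by
        rw [lintegral_mul_const _ (by fun_prop), hg, lintegral_indicator hext]
        ring

end ExteriorSteklov

namespace ExteriorSteklov

/-! ### Cutting off at infinity -/

theorem gradient_mul {n : ℕ} {φ χ : Euc n → ℝ} (hχ : Differentiable ℝ χ) (hφ : Differentiable ℝ φ)
    (x : Euc n) :
    gradient (fun y => χ y * φ y) x = χ x • gradient φ x + φ x • gradient χ x := by
  simp only [gradient]
  rw [fderiv_fun_mul (hχ x) (hφ x), map_add, map_smul, map_smul]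

theorem continuous_gradient {n : ℕ} {φ : Euc n → ℝ} (hφ : ContDiff ℝ 1 φ) :
    Continuous (gradient φ) :=
  (InnerProductSpace.toDual ℝ (Euc n)).symm.continuous.comp (hφ.continuous_fderiv (by norm_num))

theorem norm_gradient {n : ℕ} (φ : Euc n → ℝ) (x : Euc n) :
    ‖gradient φ x‖ = ‖fderiv ℝ φ x‖ := by
  simp [gradient]

/-- `χ` is a smooth cutoff function between the balls of radius `R` and `2 R` with gradient
bounded by `M`. -/
structure IsCutoff {n : ℕ} (χ : Euc n → ℝ) (R M : ℝ) : Prop where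
  contDiff : ContDiff ℝ ∞ χ
  nonneg : ∀ x, 0 ≤ χ x
  le_one : ∀ x, χ x ≤ 1
  eq_one : ∀ x, ‖x‖ ≤ R → χ x = 1
  eq_zero : ∀ x, 2 * R ≤ ‖x‖ → χ x = 0
  norm_gradient_le : ∀ x, ‖gradient χ x‖ ≤ M

/-- Rescaling one bump function makes the constant `M` independent of `R`. -/
theorem exists_isCutoff (n : ℕ) :
    ∃ M : ℝ, 0 ≤ M ∧ ∀ R : ℝ, 0 < R → ∃ χ : Euc n → ℝ, IsCutoff χ R (M * R⁻¹) := by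
  let b : ContDiffBump (0 : Euc n) := ⟨1, 2, one_pos, one_lt_two⟩
  have hb : ContDiff ℝ ∞ b := b.contDiff
  obtain ⟨M, hM⟩ := (hb.continuous_fderiv (by norm_num)).bounded_above_of_compact_support
    (b.hasCompactSupport.fderiv ℝ)
  refine ⟨M, (norm_nonneg _).trans (hM 0), fun R hR => ⟨fun x => b (R⁻¹ • x), ?_, ?_, ?_, ?_, ?_, ?_⟩⟩
  · exact hb.comp (contDiff_const_smul _)
  · exact fun x => b.nonneg
  · exact fun x => b.le_one
  · intro x hx
    refine b.one_of_mem_closedBall ?_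
    rw [mem_closedBall_zero_iff, norm_smul, norm_inv, Real.norm_of_nonneg hR.le]
    exact inv_mul_le_one_of_le₀ hx hR.le
  · intro x hx
    refine b.zero_of_le_dist ?_
    rw [dist_zero_right, norm_smul, norm_inv, Real.norm_of_nonneg hR.le, inv_mul_eq_div,
      le_div_iff₀ hR]
    exact hx
  · intro x
    rw [norm_gradient]
    have h1 : HasFDerivAt (fun x => b (R⁻¹ • x))
        ((fderiv ℝ b (R⁻¹ • x)).comp (R⁻¹ • ContinuousLinearMap.id ℝ (Euc n))) x :=
      ((hb.differentiable (by norm_num)) _).hasFDerivAt.comp x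
        ((hasFDerivAt_id x).const_smul R⁻¹)
    rw [h1.fderiv, ContinuousLinearMap.comp_smul, ContinuousLinearMap.comp_id, norm_smul, norm_inv,
      Real.norm_of_nonneg hR.le, mul_comm]
    exact mul_le_mul_of_nonneg_right (hM _) (by positivity)

namespace IsCutoff

variable {n : ℕ} {χ : Euc n → ℝ} {R M : ℝ}

theorem abs_le (hχ : IsCutoff χ R M) (x : Euc n) : |χ x| ≤ 1 := by
  rw [abs_of_nonneg (hχ.nonneg x)]
  exact hχ.le_one x

/-- At these points `χ` attains its maximum `1` or its minimum `0`, which covers the two boundary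
spheres as well. -/
theorem gradient_eq_zero (hχ : IsCutoff χ R M) {x : Euc n} (hx : ‖x‖ ≤ R ∨ 2 * R ≤ ‖x‖) :
    gradient χ x = 0 := by
  have h : fderiv ℝ χ x = 0 := by
    rcases hx with hx | hx
    · refine IsLocalMax.fderiv_eq_zero (Eventually.of_forall fun y => ?_)
      rw [hχ.eq_one x hx]
      exact hχ.le_one y
    · refine IsLocalMin.fderiv_eq_zero (Eventually.of_forall fun y => ?_)
      rw [hχ.eq_zero x hx]
      exact hχ.nonneg y
  rw [gradient, h, map_zero]

end IsCutoff

theorem IsTest.mul {n : ℕ} {φ χ : Euc n → ℝ} (hχ : ContDiff ℝ ∞ χ) (hφ : IsTest univ φ) :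
    IsTest univ (fun x => χ x * φ x) :=
  ⟨hχ.mul hφ.1, hφ.2.1.mul_left, subset_univ _⟩

theorem IsTest.memLp {n : ℕ} {U : Set (Euc n)} {φ : Euc n → ℝ} (hφ : IsTest U φ) (Ω : Set (Euc n))
    (R : ℝ) : MemLp φ 2 (truncVolume Ω R) :=
  (hφ.1.continuous.memLp_of_hasCompactSupport (μ := volume) hφ.2.1).restrict _

theorem IsTest.memLp_gradient {n : ℕ} {U : Set (Euc n)} {φ : Euc n → ℝ} (hφ : IsTest U φ)
    (Ω : Set (Euc n)) (R : ℝ) : MemLp (gradient φ) 2 (truncVolume Ω R) := by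
  have h : HasCompactSupport (gradient φ) :=
    (hφ.2.1.fderiv ℝ).comp_left (g := (InnerProductSpace.toDual ℝ (Euc n)).symm) (map_zero _)
  exact ((continuous_gradient (hφ.1.of_le (by norm_num))).memLp_of_hasCompactSupport
    (μ := volume) h).restrict _

theorem setIntegral_ext_eq_truncVolume {n : ℕ} {Ω : Set (Euc n)} {R : ℝ} {h : Euc n → ℝ}
    (hh : ∀ x, R ≤ ‖x‖ → h x = 0) : ∫ x in ext Ω, h x = ∫ x, h x ∂(truncVolume Ω R) := by
  refine setIntegral_eq_of_subset_of_forall_sdiff_eq_zero isClosed_closure.measurableSet.compl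
    inter_subset_left fun x hx => hh x ?_
  by_contra hx'
  exact hx.2 ⟨hx.1, mem_ball_zero_iff.2 (not_le.1 hx')⟩

theorem setLIntegral_ext_eq_truncVolume {n : ℕ} {Ω : Set (Euc n)} {R : ℝ} {h : Euc n → ℝ≥0∞}
    (hh : ∀ x, R ≤ ‖x‖ → h x = 0) : ∫⁻ x in ext Ω, h x = ∫⁻ x, h x ∂(truncVolume Ω R) := by
  have h1 : MeasurableSet (ext Ω) := isClosed_closure.measurableSet.compl
  rw [truncVolume, ← lintegral_indicator h1,
    ← lintegral_indicator (h1.inter Metric.isOpen_ball.measurableSet)]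
  refine lintegral_congr fun x => ?_
  by_cases hx : x ∈ ext Ω
  · by_cases hx' : R ≤ ‖x‖
    · simp [indicator, hh x hx']
    · rw [indicator_of_mem hx, indicator_of_mem (show x ∈ ext Ω ∩ Metric.ball 0 R from
        ⟨hx, mem_ball_zero_iff.2 (not_le.1 hx')⟩)]
  · rw [indicator_of_notMem hx, indicator_of_notMem fun h => hx h.1]

theorem integrable_inner_of_memLp {X E : Type*} [MeasurableSpace X] {μ : Measure X}
    [NormedAddCommGroup E] [InnerProductSpace ℝ E] {a b : X → E} (ha : MemLp a 2 μ)
    (hb : MemLp b 2 μ) : Integrable (fun x => ⟪a x, b x⟫) μ := by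
  refine (L2.integrable_inner (𝕜 := ℝ) (ha.toLp a) (hb.toLp b)).congr ?_
  filter_upwards [ha.coeFn_toLp, hb.coeFn_toLp] with x hx1 hx2
  rw [hx1, hx2]

/-- The Dirichlet energies of the truncated approximations of an eigenfunction. -/
theorem tendsto_energy_cutoff {n : ℕ} {Ω : Set (Euc n)} {u : Euc n → ℝ} {G : Euc n → Euc n}
    {f : Euc n → ℝ} {φ : ℕ → Euc n → ℝ} {χ : Euc n → ℝ} {R M σ : ℝ} (hχ : IsCutoff χ R M)
    (hχΩ : ∀ x ∈ frontier Ω, χ x = 1)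
    (hu : MemLp u 2 (truncVolume Ω (2 * R))) (hG : MemLp G 2 (truncVolume Ω (2 * R)))
    (hf : MemLp f 2 (surfaceMeasure Ω)) (hφ : ∀ k, IsTest univ (φ k))
    (hφf' : ∀ k, MemLp (φ k) 2 (surfaceMeasure Ω))
    (hφu : Tendsto (fun k => eLpNorm (fun x => φ k x - u x) 2 (truncVolume Ω (2 * R))) atTop (𝓝 0))
    (hφG : Tendsto (fun k => eLpNorm (fun x => gradient (φ k) x - G x) 2 (truncVolume Ω (2 * R)))
      atTop (𝓝 0))
    (hφf : Tendsto (fun k => eLpNorm (fun x => φ k x - f x) 2 (surfaceMeasure Ω)) atTop (𝓝 0))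
    (hn : HasNormalDerivative Ω G (fun x => σ * f x)) :
    0 ≤ σ * (∫ x, f x ^ 2 ∂(surfaceMeasure Ω)) +
      ∫ x, (u x * ‖gradient χ x‖) ^ 2 ∂(truncVolume Ω (2 * R)) ∧
    Tendsto (fun k => ∫⁻ x in ext Ω, ENNReal.ofReal (‖gradient (fun y => χ y * φ k y) x‖ ^ 2)) atTop
      (𝓝 (ENNReal.ofReal (σ * (∫ x, f x ^ 2 ∂(surfaceMeasure Ω)) +
        ∫ x, (u x * ‖gradient χ x‖) ^ 2 ∂(truncVolume Ω (2 * R))))) := by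
  have hχd : Differentiable ℝ χ := hχ.contDiff.differentiable (by norm_num)
  have hφd : ∀ k, Differentiable ℝ (φ k) := fun k => (hφ k).1.differentiable (by norm_num)
  have hχm : AEStronglyMeasurable χ (truncVolume Ω (2 * R)) :=
    hχ.contDiff.continuous.aestronglyMeasurable
  have hgc : Continuous (gradient χ) := continuous_gradient (hχ.contDiff.of_le (by norm_num))
  have hgm : AEStronglyMeasurable (gradient χ) (truncVolume Ω (2 * R)) := hgc.aestronglyMeasurable
  have hM : 0 ≤ M := (norm_nonneg _).trans (hχ.norm_gradient_le 0)
  -- the truncated function and the test function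
  have hV : MemLp (fun x => χ x • G x + u x • gradient χ x) 2 (truncVolume Ω (2 * R)) :=
    (memLp_smul_of_bound hχm hχ.abs_le hG).add
      (memLp_smul_of_bound' hgm hχ.norm_gradient_le hu)
  have hc2 : ∀ x, |χ x * χ x| ≤ max 1 (2 * M) := fun x => by
    rw [abs_mul]
    exact (mul_le_one₀ (hχ.abs_le x) (abs_nonneg _) (hχ.abs_le x)).trans (le_max_left _ _)
  have hd2 : ∀ x, ‖(2 * χ x) • gradient χ x‖ ≤ max 1 (2 * M) := fun x => by
    refine le_trans ?_ (le_max_right _ _)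
    rw [norm_smul, Real.norm_eq_abs, abs_mul, abs_two]
    have h1 := hχ.abs_le x
    have h2 := hχ.norm_gradient_le x
    have := mul_le_mul h1 h2 (norm_nonneg _) zero_le_one
    linarith
  have hc2m : AEStronglyMeasurable (fun x => χ x * χ x) (truncVolume Ω (2 * R)) := hχm.mul hχm
  have hd2m : AEStronglyMeasurable (fun x => (2 * χ x) • gradient χ x) (truncVolume Ω (2 * R)) :=
    ((continuous_const.mul hχ.contDiff.continuous).smul hgc).aestronglyMeasurable
  -- This field is the weak gradient of `χ² u`, the limit of the admissible test functions `χ² φ k`.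
  have hY : MemLp (fun x => (χ x * χ x) • G x + u x • (2 * χ x) • gradient χ x) 2
      (truncVolume Ω (2 * R)) :=
    (memLp_smul_of_bound hc2m hc2 hG).add (memLp_smul_of_bound' hd2m hd2 hu)
  have hE : MemLp (fun x => u x * ‖gradient χ x‖) 2 (truncVolume Ω (2 * R)) :=
    memLp_smul_of_bound' hgm.norm (fun x => by simpa using hχ.norm_gradient_le x) hu
  -- Green's formula
  have hgreen : ∫ x, ⟪G x, (χ x * χ x) • G x + u x • (2 * χ x) • gradient χ x⟫
      ∂(truncVolume Ω (2 * R)) = σ * ∫ x, f x ^ 2 ∂(surfaceMeasure Ω) := by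
    have h1 := tendsto_integral_inner hG
      (fun k => (memLp_smul_of_bound hc2m hc2 ((hφ k).memLp_gradient Ω (2 * R))).add
        (memLp_smul_of_bound' hd2m hd2 ((hφ k).memLp Ω (2 * R)))) hY
      (tendsto_eLpNorm_smul_add_smul hc2m hd2m hc2 hd2
        (fun k => (hφ k).memLp_gradient Ω (2 * R)) hG (fun k => (hφ k).memLp Ω (2 * R)) hu hφG hφu)
    have h2 := (tendsto_integral_inner hf hφf' hf hφf).const_mul σ
    refine tendsto_nhds_unique h1 ?_
    have h3 : ∫ x, f x ^ 2 ∂(surfaceMeasure Ω) = ∫ x, ⟪f x, f x⟫ ∂(surfaceMeasure Ω) :=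
      integral_congr_ae (ae_of_all _ fun x => by
        simp only [real_inner_self_eq_norm_sq, Real.norm_eq_abs, sq_abs])
    rw [h3]
    refine h2.congr fun k => ?_
    have h4 : ∀ x, gradient (fun y => χ y * (χ y * φ k y)) x =
        (χ x * χ x) • gradient (φ k) x + φ k x • (2 * χ x) • gradient χ x := fun x => by
      rw [gradient_mul (φ := fun y => χ y * φ k y) hχd (hχd.mul (hφd k)), gradient_mul hχd (hφd k)]
      module
    have h5 := hn _ (((hφ k).mul hχ.contDiff).mul hχ.contDiff)
    rw [setIntegral_ext_eq_truncVolume (R := 2 * R)] at h5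
    · simp only [h4] at h5
      simp only [Pi.add_apply]
      rw [h5, ← integral_const_mul]
      refine setIntegral_congr_fun isClosed_frontier.measurableSet fun x hx => ?_
      simp only [hχΩ x hx, RCLike.inner_apply, conj_trivial]
      ring
    · intro x hx
      rw [h4, hχ.eq_zero x hx]
      simp
  -- Pointwise, `|χG + u∇χ|² = ⟪G, χ²G + 2χu∇χ⟫ + u²|∇χ|²`.
  have hVnorm : ∫ x, ‖χ x • G x + u x • gradient χ x‖ ^ 2 ∂(truncVolume Ω (2 * R)) =
      σ * (∫ x, f x ^ 2 ∂(surfaceMeasure Ω)) +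
      ∫ x, (u x * ‖gradient χ x‖) ^ 2 ∂(truncVolume Ω (2 * R)) := by
    rw [← hgreen, ← integral_add (integrable_inner_of_memLp hG hY) hE.integrable_sq]
    refine integral_congr_ae (ae_of_all _ fun x => ?_)
    simp only [← real_inner_self_eq_norm_sq, inner_add_left, inner_add_right, inner_smul_left,
      inner_smul_right, mul_pow, conj_trivial, real_inner_comm (G x) (gradient χ x)]
    ring
  refine ⟨hVnorm ▸ integral_nonneg fun x => sq_nonneg _, ?_⟩
  rw [← hVnorm, ← eLpNorm_two_sq_eq_ofReal hV]
  have hm : ∀ x, |χ x| ≤ max 1 M := fun x => (hχ.abs_le x).trans (le_max_left _ _)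
  have hm' : ∀ x, ‖gradient χ x‖ ≤ max 1 M := fun x =>
    (hχ.norm_gradient_le x).trans (le_max_right _ _)
  have h1 := tendsto_eLpNorm_of_tendsto_sub
    (fun k => (memLp_smul_of_bound hχm hχ.abs_le ((hφ k).memLp_gradient Ω (2 * R))).add
        (memLp_smul_of_bound' hgm hχ.norm_gradient_le ((hφ k).memLp Ω (2 * R)))) hV
      (tendsto_eLpNorm_smul_add_smul hχm hgm hm hm'
        (fun k => (hφ k).memLp_gradient Ω (2 * R)) hG (fun k => (hφ k).memLp Ω (2 * R)) hu hφG hφu)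
  refine (ENNReal.Tendsto.pow (n := 2) h1).congr fun k => ?_
  rw [eLpNorm_two_sq, setLIntegral_ext_eq_truncVolume (R := 2 * R)]
  · simp only [gradient_mul hχd (hφd k), Pi.add_apply]
  · intro x hx
    rw [gradient_mul hχd (hφd k), hχ.eq_zero x hx, hχ.gradient_eq_zero (Or.inr hx)]
    simp

/-- The error due to the truncation of an eigenfunction vanishes in the limit. -/
theorem exists_integral_cutoff_le {n : ℕ} (hn : 3 ≤ n) {Ω : Set (Euc n)} {u : Euc n → ℝ}
    (hu : DecaysAtInfinity Ω u) (M : ℝ) : ∃ K R₀ : ℝ, 1 ≤ R₀ ∧ ∀ R, R₀ ≤ R →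
      ∀ χ : Euc n → ℝ, IsCutoff χ R (M * R⁻¹) →
        ∫ x, (u x * ‖gradient χ x‖) ^ 2 ∂(truncVolume Ω (2 * R)) ≤ K * R⁻¹ := by
  obtain ⟨C, r, hC⟩ := hu
  have hn' : (3 : ℝ) ≤ n := by exact_mod_cast hn
  refine ⟨C ^ 2 * M ^ 2 * (2 ^ n * volume.real (Metric.ball (0 : Euc n) 1)), max 1 r,
    le_max_left _ _, fun R hR χ hχ => ?_⟩
  have hR1 : 1 ≤ R := (le_max_left _ _).trans hR
  have hR0 : 0 < R := one_pos.trans_le hR1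
  -- Up to constants the integral is at most `a² · R⁻² · Rⁿ`, from the decay of `u`, the slope of
  -- `χ` and the volume. As `a Rⁿ = R²`, one factor `a ≤ R⁻¹` remains.
  set a : ℝ := R ^ (2 - (n : ℝ)) with ha
  have ha0 : 0 < a := Real.rpow_pos_of_pos hR0 _
  have ha1 : a ≤ R⁻¹ := by
    rw [← Real.rpow_neg_one]
    exact Real.rpow_le_rpow_of_exponent_le hR1 (by linarith)
  have ha2 : a * R ^ n = R ^ 2 := by
    rw [ha, ← Real.rpow_natCast, ← Real.rpow_add hR0, sub_add_cancel, Real.rpow_two]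
  have hMR : 0 ≤ M * R⁻¹ := (norm_nonneg _).trans (hχ.norm_gradient_le 0)
  have h1 : ∀ᵐ x ∂(truncVolume Ω (2 * R)),
      ‖(u x * ‖gradient χ x‖) ^ 2‖ ≤ (|C| * a * (M * R⁻¹)) ^ 2 := by
    have h2 : truncVolume Ω (2 * R) ≤ volume.restrict (ext Ω) :=
      Measure.restrict_mono inter_subset_left le_rfl
    filter_upwards [ae_mono h2 hC] with x hx
    rw [norm_pow, norm_mul, norm_norm, Real.norm_eq_abs]
    refine pow_le_pow_left₀ (by positivity) ?_ 2
    rcases le_total ‖x‖ R with hxR | hxR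
    · rw [hχ.gradient_eq_zero (Or.inl hxR), norm_zero, mul_zero]
      positivity
    · refine mul_le_mul ?_ (hχ.norm_gradient_le x) (norm_nonneg _) (by positivity)
      refine (hx (((le_max_right _ _).trans hR).trans hxR)).trans ?_
      refine mul_le_mul (le_abs_self C) ?_ (by positivity) (abs_nonneg C)
      exact Real.rpow_le_rpow_of_nonpos hR0 hxR (by linarith)
  have h2 : (truncVolume Ω (2 * R)).real univ ≤
      (2 * R) ^ n * volume.real (Metric.ball (0 : Euc n) 1) := by
    have h3 : volume.real (Metric.ball (0 : Euc n) (2 * R)) =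
        (2 * R) ^ n * volume.real (Metric.ball (0 : Euc n) 1) := by
      rw [Measure.real, Measure.addHaar_ball_of_pos volume 0 (by positivity : (0 : ℝ) < 2 * R),
        finrank_euclideanSpace_fin, ENNReal.toReal_mul, ENNReal.toReal_ofReal (by positivity),
        Measure.real]
    rw [← h3, truncVolume, measureReal_restrict_apply_univ]
    exact measureReal_mono inter_subset_right measure_ball_lt_top.ne
  have h3 : IsFiniteMeasure (truncVolume Ω (2 * R)) :=
    ⟨by
      rw [truncVolume, Measure.restrict_apply_univ]
      exact (measure_mono inter_subset_right).trans_lt measure_ball_lt_top⟩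
  calc ∫ x, (u x * ‖gradient χ x‖) ^ 2 ∂(truncVolume Ω (2 * R))
      ≤ (|C| * a * (M * R⁻¹)) ^ 2 * (truncVolume Ω (2 * R)).real univ :=
        (le_abs_self _).trans (norm_integral_le_of_norm_le_const h1)
    _ ≤ (|C| * a * (M * R⁻¹)) ^ 2 * ((2 * R) ^ n * volume.real (Metric.ball (0 : Euc n) 1)) :=
        mul_le_mul_of_nonneg_left h2 (sq_nonneg _)
    _ = C ^ 2 * M ^ 2 * (2 ^ n * volume.real (Metric.ball (0 : Euc n) 1)) *
          (a * (a * R ^ n) * R⁻¹ ^ 2) := by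
        rw [mul_pow, mul_pow, sq_abs]
        ring
    _ = C ^ 2 * M ^ 2 * (2 ^ n * volume.real (Metric.ball (0 : Euc n) 1)) * a := by
        rw [ha2]
        field_simp
    _ ≤ _ := mul_le_mul_of_nonneg_left ha1 (by positivity)

/-! ### The bound for the eigenvalues -/

/-- A curvature bound is a lower bound for all eigenvalues. -/
theorem IsEigenvalue.le_of_isCurvatureBound {n : ℕ} (hn : 3 ≤ n) {Ω : Set (Euc n)}
    (hne : Ω.Nonempty) (hopen : IsOpen Ω) (hbdd : Bornology.IsBounded Ω) (hconv : Convex ℝ Ω)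
    (hC11 : HasC11Boundary Ω) {Λ σ : ℝ} (hΛ0 : 0 ≤ Λ)
    (hΛ : IsCurvatureBound Ω (ENNReal.ofReal Λ)) (hσ : IsEigenvalue Ω σ) : Λ ≤ σ := by
  obtain ⟨u, G, f, hu0, ⟨hH1, -⟩, ⟨hf, φ', hφ', hφu', hφG', hφf'⟩, -, hnd, hdec⟩ := hσ
  obtain ⟨o, ho⟩ := hne
  -- the traces of the approximations are eventually square integrable
  obtain ⟨N, hN⟩ := eventually_atTop.1 (hφf'.eventually (gt_mem_nhds ENNReal.zero_lt_top))
  obtain ⟨φ, hφ, hφu, hφG, hφf, hφm⟩ : ∃ φ : ℕ → Euc n → ℝ, (∀ k, IsTest univ (φ k)) ∧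
      (∀ R : ℝ, Tendsto (fun k => eLpNorm (fun x => φ k x - u x) 2 (truncVolume Ω R)) atTop
        (𝓝 0)) ∧
      (∀ R : ℝ, Tendsto (fun k => eLpNorm (fun x => gradient (φ k) x - G x) 2 (truncVolume Ω R))
        atTop (𝓝 0)) ∧
      Tendsto (fun k => eLpNorm (fun x => φ k x - f x) 2 (surfaceMeasure Ω)) atTop (𝓝 0) ∧
      ∀ k, MemLp (φ k) 2 (surfaceMeasure Ω) := by
    refine ⟨fun k => φ' (k + N), fun k => hφ' _, fun R => (hφu' R).comp (tendsto_add_atTop_nat N),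
      fun R => (hφG' R).comp (tendsto_add_atTop_nat N), hφf'.comp (tendsto_add_atTop_nat N),
      fun k => ?_⟩
    have h1 : MemLp (fun x => φ' (k + N) x - f x) 2 (surfaceMeasure Ω) :=
      ⟨(hφ' _).1.continuous.aestronglyMeasurable.sub hf.1, hN _ (Nat.le_add_left _ _)⟩
    have h2 : (fun x => φ' (k + N) x - f x) + f = φ' (k + N) := by
      ext x
      simp
    exact (congrArg (MemLp · 2 (surfaceMeasure Ω)) h2).mp (h1.add hf)
  set F := ∫ x, f x ^ 2 ∂(surfaceMeasure Ω) with hF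
  have hF0 : 0 ≤ F := integral_nonneg fun x => sq_nonneg _
  obtain ⟨M, hM0, hM⟩ := exists_isCutoff n
  obtain ⟨K, R₀, hR₀, hK⟩ := exists_integral_cutoff_le hn hdec M
  obtain ⟨r, hr⟩ := hbdd.closure.subset_closedBall 0
  have hlim : Tendsto (fun R : ℝ => σ * F + K * R⁻¹) atTop (𝓝 (σ * F)) := by
    simpa using (tendsto_inv_atTop_zero.const_mul K).const_add (σ * F)
  have hlim' := ENNReal.tendsto_ofReal hlim
  have hχφ : ∀ {χ : Euc n → ℝ}, ContDiff ℝ ∞ χ → ∀ k, ContDiff ℝ 1 fun x => χ x * φ k x :=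
    fun hχ k => ((hφ k).mul hχ).1.of_le (by norm_num)
  -- the estimates for the truncated eigenfunction
  have key : ∀ R, max R₀ r ≤ R → 0 ≤ σ * F + K * R⁻¹ ∧
      ENNReal.ofReal (Λ * F) ≤ ENNReal.ofReal (σ * F + K * R⁻¹) ∧
      ∀ ρ ≤ R, ∀ k₁ : ℝ≥0∞, k₁ ≠ ⊤ → (∀ φ : Euc n → ℝ, ContDiff ℝ 1 φ → HasCompactSupport φ →
        ∫⁻ x, ENNReal.ofReal (φ x ^ 2) ∂(truncVolume Ω ρ) ≤
          k₁ * ∫⁻ x in ext Ω, ENNReal.ofReal (‖gradient φ x‖ ^ 2)) →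
        eLpNorm u 2 (truncVolume Ω ρ) ^ 2 ≤ k₁ * ENNReal.ofReal (σ * F + K * R⁻¹) := by
    intro R hR
    have hR1 : R₀ ≤ R := (le_max_left _ _).trans hR
    obtain ⟨χ, hχ⟩ := hM R (one_pos.trans_le (hR₀.trans hR1))
    have hχΩ : ∀ x ∈ frontier Ω, χ x = 1 := fun x hx => hχ.eq_one x
      ((mem_closedBall_zero_iff.1 (hr (frontier_subset_closure hx))).trans
        ((le_max_right _ _).trans hR))
    obtain ⟨h1, h2⟩ := tendsto_energy_cutoff hχ hχΩ (hH1 _).1 (hH1 _).2 hf hφ hφm (hφu _) (hφG _)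
      hφf hnd
    have h3 := add_le_add_right (hK R hR1 χ hχ) (σ * F)
    refine ⟨h1.trans h3, ?_, fun ρ hρ k₁ hk₁ hHardy => ?_⟩
    · refine le_trans ?_ (ENNReal.ofReal_le_ofReal h3)
      have h4 := tendsto_eLpNorm_of_tendsto_sub hφm hf hφf
      have h5 := ENNReal.Tendsto.const_mul (a := ENNReal.ofReal Λ)
        (ENNReal.Tendsto.pow (n := 2) h4) (Or.inr ENNReal.ofReal_ne_top)
      rw [eLpNorm_two_sq_eq_ofReal hf, ← ENNReal.ofReal_mul hΛ0] at h5
      simp only [Real.norm_eq_abs, sq_abs] at h5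
      refine le_of_tendsto_of_tendsto' h5 h2 fun k => ?_
      refine le_trans (le_of_eq ?_) (mul_lintegral_sq_le_energy hopen hbdd hconv hC11 hΛ
        (hχφ hχ.contDiff k) ((hφ k).mul hχ.contDiff).2.1)
      rw [eLpNorm_two_sq]
      congr 1
      refine setLIntegral_congr_fun isClosed_frontier.measurableSet fun x hx => ?_
      simp only [hχΩ x hx, one_mul, Real.norm_eq_abs, sq_abs]
    · refine le_trans ?_ (mul_le_mul' le_rfl (ENNReal.ofReal_le_ofReal h3))
      have h4 := ENNReal.Tendsto.pow (n := 2) (tendsto_eLpNorm_of_tendsto_sub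
        (fun k => (hφ k).memLp Ω ρ) (hH1 ρ).1 (hφu ρ))
      refine le_of_tendsto_of_tendsto' h4
        (ENNReal.Tendsto.const_mul (a := k₁) h2 (Or.inr hk₁)) fun k => ?_
      refine le_trans (le_of_eq ?_) (hHardy _ (hχφ hχ.contDiff k) ((hφ k).mul hχ.contDiff).2.1)
      rw [eLpNorm_two_sq]
      refine setLIntegral_congr_fun (isClosed_closure.measurableSet.compl.inter
        Metric.isOpen_ball.measurableSet) fun x hx => ?_
      have hx' : ‖x‖ ≤ R := (mem_ball_zero_iff.1 hx.2).le.trans hρ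
      simp only [hχ.eq_one x hx', one_mul, Real.norm_eq_abs, sq_abs]
  -- The sign must be known before leaving `ℝ≥0∞`, since `ENNReal.ofReal` truncates negative numbers
  -- to zero.
  have hσF : 0 ≤ σ * F := ge_of_tendsto hlim
    ((eventually_ge_atTop (max R₀ r)).mono fun R hR => (key R hR).1)
  have hΛF : Λ * F ≤ σ * F := by
    rw [← ENNReal.ofReal_le_ofReal_iff hσF]
    exact ge_of_tendsto hlim' ((eventually_ge_atTop (max R₀ r)).mono fun R hR => (key R hR).2.1)
  rcases hF0.lt_or_eq with hF1 | hF1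
  · exact le_of_mul_le_mul_right hΛF hF1
  -- In the remaining case `F = 0` the energies of the truncations tend to zero as `R → ∞`, and the
  -- Hardy-type inequality makes `u` vanish on every ball.
  refine absurd ?_ hu0
  have hzero : ∀ ρ : ℝ, ∀ᵐ x ∂(truncVolume Ω ρ), u x = 0 := fun ρ => by
    obtain ⟨k₁, hk₁, hHardy⟩ := exists_lintegral_sq_le_energy hn hconv ho ρ
    have h1 : eLpNorm u 2 (truncVolume Ω ρ) ^ 2 ≤ k₁ * ENNReal.ofReal (σ * F) :=
      ge_of_tendsto (ENNReal.Tendsto.const_mul hlim' (Or.inr hk₁))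
        ((eventually_ge_atTop (max (max R₀ r) ρ)).mono fun R hR =>
          (key R ((le_max_left _ _).trans hR)).2.2 ρ ((le_max_right _ _).trans hR) k₁ hk₁ hHardy)
    rw [← hF1, mul_zero, ENNReal.ofReal_zero, mul_zero, nonpos_iff_eq_zero,
      pow_eq_zero_iff two_ne_zero, eLpNorm_eq_zero_iff (hH1 ρ).1.1 two_ne_zero] at h1
    exact h1
  have hcover : ext Ω = ⋃ k : ℕ, ext Ω ∩ Metric.ball 0 (k : ℝ) := by
    rw [← inter_iUnion, Metric.iUnion_ball_nat, inter_univ]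
  rw [EventuallyEq, hcover, ae_restrict_iUnion_iff]
  exact fun k => hzero k

end ExteriorSteklov

theorem mainTheorem1 (n : ℕ) (hn : 3 ≤ n) (Ω : Set (ExteriorSteklov.Euc n))
    (hne : Ω.Nonempty) (hopen : IsOpen Ω) (hbdd : Bornology.IsBounded Ω) (hconv : Convex ℝ Ω)
    (hC11 : ExteriorSteklov.HasC11Boundary Ω) :
    ((((n : ℝ) - 2) *
        sInf {l : ℝ | ∃ (s : ExteriorSteklov.Euc n) (κ : Fin (n - 1) → ℝ),
          ExteriorSteklov.HasPrincipalCurvatures Ω s κ ∧ l = ExteriorSteklov.logMean κ} : ℝ) :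
          EReal) ≤
      ExteriorSteklov.firstEigenvalue Ω := by
  have hk : 2 ≤ n - 1 := by omega
  have hn2 : (0 : ℝ) ≤ n - 2 := by
    have : (3 : ℝ) ≤ n := by exact_mod_cast hn
    linarith
  have hpos : ∀ l ∈ {l : ℝ | ∃ (s : ExteriorSteklov.Euc n) (κ : Fin (n - 1) → ℝ),
      ExteriorSteklov.HasPrincipalCurvatures Ω s κ ∧ l = ExteriorSteklov.logMean κ}, 0 ≤ l := by
    rintro _ ⟨s, κ, hκ, rfl⟩
    exact ExteriorSteklov.logMean_nonneg hk (hκ.nonneg hopen hconv hC11)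
  refine le_iInf₂ fun σ hσ => EReal.coe_le_coe_iff.2 ?_
  -- Nonnegativity of the infimum holds by `Real.sInf_nonneg` even under the convention that an
  -- empty set has infimum `0`.
  refine ExteriorSteklov.IsEigenvalue.le_of_isCurvatureBound hn hne hopen hbdd hconv hC11
    (mul_nonneg hn2 (Real.sInf_nonneg hpos)) (fun s κ hκ => ?_) hσ
  rw [← ExteriorSteklov.ofReal_mul_logMean hk (hκ.nonneg hopen hconv hC11)]
  -- There are `k = n - 1` curvatures, so the factor `k - 1` of the integral formula is `n - 2`.
  have hcast : ((n - 1 : ℕ) : ℝ) - 1 = n - 2 := by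
    rw [Nat.cast_sub (by omega)]
    push_cast
    ring
  rw [hcast]
  exact ENNReal.ofReal_le_ofReal (mul_le_mul_of_nonneg_left
    (csInf_le ⟨0, hpos⟩ ⟨s, κ, hκ, rfl⟩) hn2)
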